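/- For $0<\nu<1$ put $m=\frac{3}{16}(1-\nu)$ and $L=\frac14\ln\frac4\nu$ (so $\nu=4e^{-4L}$), and let $r=r(x,\nu)$ be the even positive solution on $\mathbb R$, vanishing at infinity, of $-mr''+mr-r^3+r^5=0$, that is $$r(x,\nu)^2=\frac34\,\frac{1-\nu}{1+\sqrt\nu\cosh 2x}.$$ Let $\sigma=\frac{\partial}{\partial L}\,r(x,4e^{-4L})=-4\nu\,\frac{\partial r}{\partial\nu}$ and $\rho=\frac{4\nu}{1-\nu}(r^5-r^3)$. Let $A$ be the unbounded operator in $L^2(\mathbb R)$ with domain $D(A)=H^2(\mathbb R)$ and $$Au=-mu''+(m-3r^2+5r^4)u,$$ let $\lambda=\lambda(\nu)$ be the infimum of the spectrum of $A$, and let $\Pi$ be the orthogonal projection of $L^2(\mathbb R)$ onto the sum of the eigenspaces of $A$ for $0$ and for $\lambda$. **Theorem 2.8.** There are constants $\nu_0\in(0,1]$ and $C$ such that for every $\nu\in(0,\nu_0)$ the functions $\sigma$ and $\rho$ belong to $L^2(\mathbb R)$, the functions $\sigma$ and $\Pi\sigma$ belong to $H^2(\mathbb R)$, and the following hold. 1.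 $|\sigma-\Pi\sigma|_{H^2(\mathbb R)}\le C\,\nu\sqrt L$. 2. $\lambda$ is the least element of the spectrum of $A$, and $\left|\lambda+\frac{3\nu}{2}\right|\le C\,\nu^{3/2}$. 3. $\Pi\sigma\ne0$ and $A\Pi\sigma=\lambda\,\Pi\sigma$; thus $s=\Pi\sigma$ is an eigenvector of $A$ for the eigenvalue $\lambda$. 4. There is a unique $\hat\sigma\in H^2(\mathbb R)$ with $$\Pi\hat\sigma=0,\qquad A\hat\sigma=(\mathbf 1-\Pi)(\lambda\sigma-\rho),$$ and it satisfies $|\Pi\sigma-\sigma-\hat\sigma|_{H^2(\mathbb R)}\le C\,\nu^2\sqrt L$. -/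

import Mathlib

open MeasureTheory
open scoped ENNReal ContDiff

namespace PulseOperator

noncomputable section

/-! ## The space `H²(ℝ)` through weak derivatives -/

/-- The real Hilbert space `L²(ℝ)`. -/
abbrev L2R : Type := Lp ℝ 2 (volume : Measure ℝ)

/-- `v` is the weak (distributional) derivative of `u`. -/
def HasWeakDeriv (u v : L2R) : Prop :=
  ∀ φ : ℝ → ℝ, ContDiff ℝ ∞ φ → HasCompactSupport φ →
    ∫ x, u x * deriv φ x = -∫ x, v x * φ x

theorem L2R.locallyIntegrable (u : L2R) : LocallyIntegrable u volume :=
  (Lp.memLp u).locallyIntegrable (by norm_num)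

theorem L2R.integrable_mul (u : L2R) {φ : ℝ → ℝ} (hφ : Continuous φ)
    (hc : HasCompactSupport φ) : Integrable (fun x => u x * φ x) volume := by
  simpa [smul_eq_mul, mul_comm] using
    (L2R.locallyIntegrable u).integrable_smul_left_of_hasCompactSupport hφ hc

theorem HasWeakDeriv.unique {u v w : L2R} (hv : HasWeakDeriv u v) (hw : HasWeakDeriv u w) :
    v = w := by
  apply Lp.ext
  refine ae_eq_of_integral_contDiff_smul_eq (L2R.locallyIntegrable v)
    (L2R.locallyIntegrable w) fun φ hφ hc => ?_
  have h := (hv φ hφ hc).symm.trans (hw φ hφ hc)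
  simpa [smul_eq_mul, mul_comm] using h

theorem HasWeakDeriv.add {u₁ u₂ v₁ v₂ : L2R} (h₁ : HasWeakDeriv u₁ v₁)
    (h₂ : HasWeakDeriv u₂ v₂) : HasWeakDeriv (u₁ + u₂) (v₁ + v₂) := by
  intro φ hφ hc
  have hd : Continuous (deriv φ) := hφ.continuous_deriv (by simp)
  have e₁ : (∫ x, (u₁ + u₂ : L2R) x * deriv φ x)
      = ∫ x, (u₁ x * deriv φ x + u₂ x * deriv φ x) := by
    refine integral_congr_ae ?_
    filter_upwards [Lp.coeFn_add u₁ u₂] with x hx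
    rw [hx, Pi.add_apply, add_mul]
  have e₂ : (∫ x, (v₁ + v₂ : L2R) x * φ x) = ∫ x, (v₁ x * φ x + v₂ x * φ x) := by
    refine integral_congr_ae ?_
    filter_upwards [Lp.coeFn_add v₁ v₂] with x hx
    rw [hx, Pi.add_apply, add_mul]
  rw [e₁, e₂, integral_add (L2R.integrable_mul u₁ hd hc.deriv)
      (L2R.integrable_mul u₂ hd hc.deriv),
    integral_add (L2R.integrable_mul v₁ hφ.continuous hc)
      (L2R.integrable_mul v₂ hφ.continuous hc), h₁ φ hφ hc, h₂ φ hφ hc]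
  ring

theorem HasWeakDeriv.smul {u v : L2R} (c : ℝ) (h : HasWeakDeriv u v) :
    HasWeakDeriv (c • u) (c • v) := by
  intro φ hφ hc
  have e₁ : (∫ x, (c • u : L2R) x * deriv φ x) = ∫ x, c * (u x * deriv φ x) := by
    refine integral_congr_ae ?_
    filter_upwards [Lp.coeFn_smul c u] with x hx
    rw [hx, Pi.smul_apply, smul_eq_mul, mul_assoc]
  have e₂ : (∫ x, (c • v : L2R) x * φ x) = ∫ x, c * (v x * φ x) := by
    refine integral_congr_ae ?_
    filter_upwards [Lp.coeFn_smul c v] with x hx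
    rw [hx, Pi.smul_apply, smul_eq_mul, mul_assoc]
  rw [e₁, e₂, integral_const_mul, integral_const_mul, h φ hφ hc]
  ring

theorem HasWeakDeriv.zero : HasWeakDeriv 0 0 := by
  have h0 : HasWeakDeriv ((0 : ℝ) • (0 : L2R)) ((0 : ℝ) • (0 : L2R)) := by
    intro φ _ _
    have e : ∀ ψ : ℝ → ℝ, (∫ x, ((0 : ℝ) • (0 : L2R) : L2R) x * ψ x) = 0 := by
      intro ψ
      rw [zero_smul]
      refine (integral_congr_ae ?_).trans (integral_zero ℝ ℝ)
      filter_upwards [Lp.coeFn_zero ℝ 2 (volume : Measure ℝ)] with x hx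
      rw [hx, Pi.zero_apply, zero_mul]
    rw [e, e, neg_zero]
  simpa using h0

/-- `H²(ℝ)`: the functions in `L²(ℝ)` whose first and second weak derivatives are in
`L²(ℝ)`. -/
def H2 : Submodule ℝ L2R where
  carrier := {u | ∃ u' u'' : L2R, HasWeakDeriv u u' ∧ HasWeakDeriv u' u''}
  add_mem' := by
    rintro a b ⟨a', a'', h₁, h₂⟩ ⟨b', b'', h₃, h₄⟩
    exact ⟨a' + b', a'' + b'', h₁.add h₃, h₂.add h₄⟩
  zero_mem' := ⟨0, 0, HasWeakDeriv.zero, HasWeakDeriv.zero⟩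
  smul_mem' := by
    rintro c a ⟨a', a'', h₁, h₂⟩
    exact ⟨c • a', c • a'', h₁.smul c, h₂.smul c⟩

open Classical in
/-- The weak derivative of `u` (zero if there is none in `L²(ℝ)`). -/
def weakDeriv (u : L2R) : L2R :=
  if h : ∃ v, HasWeakDeriv u v then h.choose else 0

theorem HasWeakDeriv.weakDeriv_eq {u v : L2R} (h : HasWeakDeriv u v) : weakDeriv u = v := by
  have hex : ∃ v, HasWeakDeriv u v := ⟨v, h⟩
  rw [weakDeriv, dif_pos hex]
  exact hex.choose_spec.unique h

/-- The second weak derivative as a linear map on `H²(ℝ)`. -/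
def secondDeriv : H2 →ₗ[ℝ] L2R where
  toFun u := weakDeriv (weakDeriv (u : L2R))
  map_add' := by
    rintro ⟨a, a', a'', h₁, h₂⟩ ⟨b, b', b'', h₃, h₄⟩
    simp only [Submodule.coe_add]
    rw [(h₁.add h₃).weakDeriv_eq, (h₂.add h₄).weakDeriv_eq, h₁.weakDeriv_eq,
      h₂.weakDeriv_eq, h₃.weakDeriv_eq, h₄.weakDeriv_eq]
  map_smul' := by
    rintro c ⟨a, a', a'', h₁, h₂⟩
    simp only [Submodule.coe_smul, RingHom.id_apply]
    rw [(h₁.smul c).weakDeriv_eq, (h₂.smul c).weakDeriv_eq, h₁.weakDeriv_eq,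
      h₂.weakDeriv_eq]

/-- The norm of `H²(ℝ)`, for `u ∈ H2`. -/
def H2norm (u : L2R) : ℝ :=
  √(‖u‖ ^ 2 + ‖weakDeriv u‖ ^ 2 + ‖weakDeriv (weakDeriv u)‖ ^ 2)

/-! ## Spectrum of an unbounded operator -/

section Unbounded

variable {H : Type*} [NormedAddCommGroup H] [NormedSpace ℝ H]

/-- The real resolvent set of an unbounded operator `T`: the numbers `μ` for which `T - μ` is a
bijection from the domain of `T` onto `H` with a bounded inverse `S`. -/
def opResolventSet (T : H →ₗ.[ℝ] H) : Set ℝ :=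
  {μ | ∃ S : H →L[ℝ] H,
    (∀ f : H, ∃ u : T.domain, (u : H) = S f ∧ T u - μ • (u : H) = f) ∧
    ∀ u : T.domain, S (T u - μ • (u : H)) = u}

/-- The (real) spectrum of an unbounded operator. -/
def opSpectrum (T : H →ₗ.[ℝ] H) : Set ℝ := (opResolventSet T)ᶜ

/-- The space of the solutions of `T u = μ u`. -/
def opEigenspace (T : H →ₗ.[ℝ] H) (μ : ℝ) : Submodule ℝ H where
  carrier := {u | ∃ h : u ∈ T.domain, T ⟨u, h⟩ = μ • u}
  add_mem' := by
    rintro a b ⟨ha, ea⟩ ⟨hb, eb⟩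
    refine ⟨T.domain.add_mem ha hb, ?_⟩
    rw [smul_add, ← ea, ← eb, ← LinearPMap.map_add]
    rfl
  zero_mem' := ⟨T.domain.zero_mem, by
    rw [smul_zero]
    exact LinearPMap.map_zero T⟩
  smul_mem' := by
    rintro c a ⟨ha, ea⟩
    refine ⟨T.domain.smul_mem c ha, ?_⟩
    rw [smul_comm, ← ea, ← LinearPMap.map_smul]
    rfl

end Unbounded

/-! ## The pulse and the operator linearized around it -/

/-- `m = 3 (1 - ν) / 16`. -/
def mass (ν : ℝ) : ℝ := 3 / 16 * (1 - ν)

/-- `R = r²`. -/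
def pulseSq (ν x : ℝ) : ℝ := 3 / 4 * (1 - ν) / (1 + √ν * Real.cosh (2 * x))

/-- The pulse `r(x, ν)`; `pulse_spec` below shows that it is a positive even solution of
`-m r'' + m r - r³ + r⁵ = 0` which vanishes at infinity. -/
def pulse (ν x : ℝ) : ℝ := √(pulseSq ν x)

/-- The half-length `L` of the shelf, for which `ν = 4 exp (-4 L)`. -/
def shelf (ν : ℝ) : ℝ := 1 / 4 * Real.log (4 / ν)

/-- `σ = ∂r/∂L`. -/
def sigma (ν x : ℝ) : ℝ := deriv (fun l : ℝ => pulse (4 * Real.exp (-4 * l)) x) (shelf ν)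

/-- `ρ = 4 ν (r⁵ - r³) / (1 - ν)`. -/
def rho (ν x : ℝ) : ℝ := 4 * ν / (1 - ν) * (pulse ν x ^ 5 - pulse ν x ^ 3)

/-- The potential `V = m - 3 r² + 5 r⁴`. -/
def potential (ν x : ℝ) : ℝ := mass ν - 3 * pulse ν x ^ 2 + 5 * pulse ν x ^ 4

theorem one_le_denom (ν x : ℝ) : 1 ≤ 1 + √ν * Real.cosh (2 * x) := by
  have := mul_nonneg (Real.sqrt_nonneg ν) (Real.cosh_pos (2 * x)).le
  linarith

theorem continuous_pulse (ν : ℝ) : Continuous (pulse ν) := by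
  unfold pulse pulseSq
  refine Real.continuous_sqrt.comp (Continuous.div continuous_const
    (continuous_const.add (continuous_const.mul
      (Real.continuous_cosh.comp (continuous_const.mul continuous_id)))) fun x => ?_)
  exact (zero_lt_one.trans_le (one_le_denom ν x)).ne'

theorem pulse_le (ν x : ℝ) : pulse ν x ≤ √(3 / 4 * |1 - ν|) := by
  refine Real.sqrt_le_sqrt ?_
  have h := one_le_denom ν x
  rw [pulseSq, div_le_iff₀ (by linarith)]
  have h₁ := le_abs_self (1 - ν)
  have h₂ := abs_nonneg (1 - ν)
  nlinarith

theorem memLp_potential (ν : ℝ) : MemLp (potential ν) ∞ (volume : Measure ℝ) := by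
  have hc : Continuous (potential ν) := by
    have := continuous_pulse ν
    unfold potential
    fun_prop
  refine memLp_top_of_bound hc.aestronglyMeasurable
    (|mass ν| + 3 * √(3 / 4 * |1 - ν|) ^ 2 + 5 * √(3 / 4 * |1 - ν|) ^ 4)
    (Filter.Eventually.of_forall fun x => ?_)
  have h₀ : 0 ≤ pulse ν x := Real.sqrt_nonneg _
  have h₂ := pow_le_pow_left₀ h₀ (pulse_le ν x) 2
  have h₄ := pow_le_pow_left₀ h₀ (pulse_le ν x) 4
  have p₂ : 0 ≤ pulse ν x ^ 2 := by positivity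
  have p₄ : 0 ≤ pulse ν x ^ 4 := by positivity
  have a₁ := neg_abs_le (mass ν)
  have a₂ := le_abs_self (mass ν)
  rw [Real.norm_eq_abs, abs_le, potential]
  constructor <;> linarith

/-- Multiplication by the potential, on `L²(ℝ)`. -/
def potentialMul (ν : ℝ) : L2R →ₗ[ℝ] L2R where
  toFun u := ((memLp_potential ν).toLp (potential ν) • u : L2R)
  map_add' := Lp.add_smul _
  map_smul' c u := by
    exact (Lp.smul_comm c _ u).symm

theorem potentialMul_coe (ν : ℝ) (u : L2R) :
    potentialMul ν u =ᵐ[volume] fun x => potential ν x * u x := by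
  change (((memLp_potential ν).toLp (potential ν) • u : L2R) : ℝ → ℝ) =ᵐ[volume] _
  filter_upwards [Lp.coeFn_lpSMul (r := 2) ((memLp_potential ν).toLp (potential ν)) u,
    (memLp_potential ν).coeFn_toLp] with x h₁ h₂
  rw [h₁, Pi.smul_apply', h₂, smul_eq_mul]

/-- The unbounded operator `A u = -m u'' + V u` in `L²(ℝ)`, with domain `H²(ℝ)`. -/
def opA (ν : ℝ) : L2R →ₗ.[ℝ] L2R where
  domain := H2
  toFun := -(mass ν • secondDeriv) + (potentialMul ν).comp H2.subtype

/-- The infimum `λ` of the spectrum of `A`. -/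
def lam (ν : ℝ) : ℝ := sInf (opSpectrum (opA ν))

/-- The orthogonal projection `Π` of `L²(ℝ)` onto the sum of the eigenspaces of `A` for `0` and
`λ`. (The closure makes the definition independent of a proof that this sum is closed.) -/
def proj (ν : ℝ) : L2R →L[ℝ] L2R :=
  (opEigenspace (opA ν) 0 ⊔ opEigenspace (opA ν) (lam ν)).topologicalClosure.starProjection

/-- The pulse is even, positive, vanishes at infinity, and solves its differential equation. -/
theorem pulse_spec {ν : ℝ} (h0 : 0 < ν) (h1 : ν < 1) :
    (∀ x, pulse ν (-x) = pulse ν x) ∧ (∀ x, 0 < pulse ν x) ∧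
    Filter.Tendsto (pulse ν) (Filter.cocompact ℝ) (nhds 0) ∧
    ∃ r' r'' : ℝ → ℝ, (∀ x, HasDerivAt (pulse ν) (r' x) x) ∧ (∀ x, HasDerivAt r' (r'' x) x) ∧
      ∀ x, -mass ν * r'' x + mass ν * pulse ν x - pulse ν x ^ 3 + pulse ν x ^ 5 = 0 := by
  have hD : ∀ x, 0 < 1 + √ν * Real.cosh (2 * x) := fun x =>
    zero_lt_one.trans_le (one_le_denom ν x)
  have hR : ∀ x, 0 < pulseSq ν x := fun x => by
    unfold pulseSq
    exact div_pos (by linarith) (hD x)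
  have hs : 0 < √ν := Real.sqrt_pos.2 h0
  have hp : ∀ x, 0 < pulse ν x := fun x => Real.sqrt_pos.2 (hR x)
  have hc : ∀ x : ℝ, HasDerivAt (fun y => Real.cosh (2 * y)) (Real.sinh (2 * x) * 2) x :=
    fun x => (Real.hasDerivAt_cosh (2 * x)).comp x (by simpa using (hasDerivAt_id x).const_mul 2)
  have hsh : ∀ x : ℝ, HasDerivAt (fun y => Real.sinh (2 * y)) (Real.cosh (2 * x) * 2) x :=
    fun x => (Real.hasDerivAt_sinh (2 * x)).comp x (by simpa using (hasDerivAt_id x).const_mul 2)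
  have hDd : ∀ x : ℝ, HasDerivAt (fun y => 1 + √ν * Real.cosh (2 * y))
      (√ν * (Real.sinh (2 * x) * 2)) x := fun x => ((hc x).const_mul _).const_add 1
  have hr : ∀ x, HasDerivAt (pulse ν)
      (pulse ν x * (-(√ν * Real.sinh (2 * x)) / (1 + √ν * Real.cosh (2 * x)))) x := by
    intro x
    have h := ((hasDerivAt_const x (3 / 4 * (1 - ν))).div (hDd x) (hD x).ne').sqrt (hR x).ne'
    refine h.congr_deriv ?_
    have e : √(((fun _ : ℝ => 3 / 4 * (1 - ν)) / fun y : ℝ => 1 + √ν * Real.cosh (2 * y)) x)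
        = pulse ν x := rfl
    have hx := Real.sq_sqrt (hR x).le
    change pulse ν x ^ 2 = 3 / 4 * (1 - ν) / (1 + √ν * Real.cosh (2 * x)) at hx
    rw [e]
    have hd := (hD x).ne'
    have hq := (hp x).ne'
    rw [eq_div_iff hd] at hx
    field_simp
    linear_combination (8 * √ν * Real.sinh (2 * x)) * hx
  refine ⟨fun x => ?_, hp, ?_, _, fun x =>
    pulse ν x * (-(√ν * Real.sinh (2 * x)) / (1 + √ν * Real.cosh (2 * x))) *
        (-(√ν * Real.sinh (2 * x)) / (1 + √ν * Real.cosh (2 * x))) +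
      pulse ν x * ((-(√ν * (Real.cosh (2 * x) * 2)) * (1 + √ν * Real.cosh (2 * x)) -
        -(√ν * Real.sinh (2 * x)) * (√ν * (Real.sinh (2 * x) * 2))) /
          (1 + √ν * Real.cosh (2 * x)) ^ 2), hr, fun x => ?_, fun x => ?_⟩
  · simp [pulse, pulseSq]
  · have hlim : Filter.Tendsto (fun x : ℝ => 1 + √ν * Real.cosh (2 * x))
        (Filter.cocompact ℝ) Filter.atTop := by
      refine Filter.tendsto_atTop_add_const_left _ _ (Filter.Tendsto.const_mul_atTop hs ?_)
      refine Filter.tendsto_atTop_mono (fun x => ?_) (tendsto_norm_cocompact_atTop (E := ℝ))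
      have e₁ := Real.add_one_le_exp |2 * x|
      have e₂ := Real.exp_pos (-|2 * x|)
      rw [← Real.cosh_abs (2 * x), Real.cosh_eq, Real.norm_eq_abs]
      rw [abs_mul, abs_two] at *
      linarith
    have h := (hlim.const_div_atTop (3 / 4 * (1 - ν))).sqrt
    rw [Real.sqrt_zero] at h
    exact h
  · exact (hr x).mul (((hsh x).const_mul (√ν)).neg.div (hDd x) (hD x).ne')
  · beta_reduce
    have hx := Real.sq_sqrt (hR x).le
    change pulse ν x ^ 2 = 3 / 4 * (1 - ν) / (1 + √ν * Real.cosh (2 * x)) at hx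
    have hd := (hD x).ne'
    have hν := Real.sq_sqrt h0.le
    have hch := Real.sinh_sq (2 * x)
    have e₃ : pulse ν x ^ 3 = pulse ν x * pulse ν x ^ 2 := by ring
    have e₅ : pulse ν x ^ 5 = pulse ν x * (pulse ν x ^ 2) ^ 2 := by ring
    rw [e₃, e₅, hx, mass]
    generalize pulse ν x = p at *
    generalize Real.sinh (2 * x) = S at *
    generalize Real.cosh (2 * x) = c at *
    generalize √ν = s at *
    subst hν
    field_simp
    linear_combination (-144 * s ^ 2 * p * (1 - s ^ 2)) * hch

end

end PulseOperator

/-! For small `ν` the pulse is a long plateau with two steep edges. The derivative `r'` moves the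
edges in parallel and `σ` moves them apart, so the two span the slow modes. Differentiating the
pulse equation in `x` and in `L` gives `A r' = 0` and `A σ = ρ`, with `ρ` of size `ν √L`. The
theorem follows from a spectral gap, uniform in `ν`, on the orthogonal complement of these two
modes.

Gap. With `u = 1 / (1 + √ν cosh 2x)`, the potential divided by `m` is a polynomial in `u`, and `u' =
-2 tanh(2x) u (1 - u)`. On functions vanishing at the two points where `u = 1/3`, explicit Riccati
subsolutions show that the form of `A` is at least `m/50` times the squared norm (`riccati_outer`,
`riccati_inner`, `dirichlet_bound`). As `ν → 0` these points approach the peaks of `|r'|` and `σ`.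
Any `v` is brought to vanish there by subtracting multiples of the odd `r'` and the even `σ`; if `v`
is orthogonal to both, this costs little energy because `ρ` is small. Hence the gap `1/600` of
`formGap_energy`.

Eigenvalue. Integrating the derivative of `tanh(2x) u^k` gives `k ∫ u^k (1 - u) = 1 + O(√ν)`
(`abs_profMoment_sub_le`). Therefore `‖σ‖² ≈ 3/8` and `⟨ρ, σ⟩ ≈ -9ν/16`, and the Rayleigh quotient
of `σ` is `a ≈ -3ν/2`. A Schur complement over the line of `σ` (`exists_groundState`) yields an
eigenvalue `l ≤ a` with `a - l` at most a constant times `‖ρ‖² = O(ν² L)`. The gap persists with the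
eigenvector `e` in place of `σ`, so `l` is the bottom of the spectrum and `Π` projects onto the span
of `r'` and `e` (`exists_isBottom`, `IsBottom.proj_eq`).

Estimates. By parity `σ ⟂ r'`, so `Πσ` is a nonzero multiple of `e`. The remainder `y = σ - Πσ`
solves `A y = (1 - Π) ρ` in the gapped subspace, so it is bounded by `‖ρ‖`. There `σ̂ = -(y + d)`
with `A d = -λ y`, so `Πσ - σ - σ̂ = d` gains one more factor `|λ| = O(ν)`. The equation itself
converts `L²` bounds into `H²` bounds (`H2norm_le`). -/

namespace PulseOperator

noncomputable section

open Filter Topology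

/-! ## Primitives of locally integrable functions -/

/-- `U` is a primitive of the locally integrable function `v`. -/
def IsPrimitive (U v : ℝ → ℝ) : Prop :=
  LocallyIntegrable v volume ∧ ∀ a b, ∫ x in a..b, v x = U b - U a

namespace IsPrimitive

variable {U V v w : ℝ → ℝ}

theorem intervalIntegrable (h : IsPrimitive U v) (a b : ℝ) : IntervalIntegrable v volume a b :=
  (h.1.integrableOn_isCompact isCompact_uIcc).intervalIntegrable

theorem eq_add (h : IsPrimitive U v) : U = fun x => U 0 + ∫ y in (0 : ℝ)..x, v y := by
  funext x
  rw [h.2]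
  ring

theorem continuous (h : IsPrimitive U v) : Continuous U := by
  rw [h.eq_add]
  exact continuous_const.add
    (intervalIntegral.continuous_primitive (fun a b => h.intervalIntegrable a b) 0)

theorem ae_hasDerivAt (h : IsPrimitive U v) : ∀ᵐ x, HasDerivAt U (v x) x := by
  filter_upwards [LocallyIntegrable.ae_hasDerivAt_integral h.1] with x hx
  rw [h.eq_add]
  exact (hx 0).const_add _

theorem absolutelyContinuous (h : IsPrimitive U v) (a b : ℝ) :
    AbsolutelyContinuousOnInterval U a b := by
  have e : U = (fun _ => U a) + fun x => ∫ y in a..x, v y := by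
    funext x
    rw [Pi.add_apply, h.2]
    ring
  rw [e]
  refine AbsolutelyContinuousOnInterval.add ?_
    ((h.intervalIntegrable a b).absolutelyContinuousOnInterval_intervalIntegral (by simp))
  exact (LipschitzWith.const (U a)).lipschitzOnWith.absolutelyContinuousOnInterval

theorem mul (hU : IsPrimitive U v) (hV : IsPrimitive V w) :
    IsPrimitive (fun x => U x * V x) (fun x => v x * V x + U x * w x) := by
  refine ⟨(?_ : LocallyIntegrable _ _).add ?_, fun a b => ?_⟩
  · exact hU.1.mul_continuous hV.continuous
  · exact hV.1.continuous_mul hU.continuous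
  · rw [← AbsolutelyContinuousOnInterval.integral_deriv_mul_eq_sub (hU.absolutelyContinuous a b)
      (hV.absolutelyContinuous a b)]
    refine intervalIntegral.integral_congr_ae ?_
    filter_upwards [hU.ae_hasDerivAt, hV.ae_hasDerivAt] with x h₁ h₂ _
    rw [h₁.deriv, h₂.deriv]

theorem add (hU : IsPrimitive U v) (hV : IsPrimitive V w) :
    IsPrimitive (fun x => U x + V x) (fun x => v x + w x) := by
  refine ⟨hU.1.add hV.1, fun a b => ?_⟩
  rw [intervalIntegral.integral_add (hU.intervalIntegrable a b) (hV.intervalIntegrable a b),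
    hU.2, hV.2]
  ring

theorem const_mul (c : ℝ) (hU : IsPrimitive U v) :
    IsPrimitive (fun x => c * U x) (fun x => c * v x) := by
  refine ⟨hU.1.smul c, fun a b => ?_⟩
  rw [intervalIntegral.integral_const_mul, hU.2]
  ring

theorem of_hasDerivAt (h : ∀ x, HasDerivAt U (v x) x) (hv : Continuous v) : IsPrimitive U v :=
  ⟨hv.locallyIntegrable, fun a b => intervalIntegral.integral_eq_sub_of_hasDerivAt
    (fun x _ => h x) (hv.intervalIntegrable a b)⟩

theorem congr_ae (h : IsPrimitive U v) (e : v =ᵐ[volume] w) : IsPrimitive U w := by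
  refine ⟨h.1.congr e, fun a b => ?_⟩
  rw [← h.2 a b]
  exact intervalIntegral.integral_congr_ae (by filter_upwards [e] with x hx _ using hx.symm)

/-- A limit exists because the derivative is integrable. It must be zero because `U` is integrable
and every neighbourhood of infinity has infinite measure. -/
theorem tendsto_atTop (h : IsPrimitive U v) (hU : Integrable U) (hv : Integrable v) :
    Tendsto U atTop (𝓝 0) := by
  have h₁ : Tendsto U atTop (𝓝 (U 0 + ∫ x in Set.Ioi 0, v x)) := by
    refine Tendsto.congr (fun x => (congrFun h.eq_add x).symm) ?_
    exact (intervalIntegral_tendsto_integral_Ioi 0 hv.integrableOn tendsto_id).const_add _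
  have h₂ : IntegrableAtFilter U atTop := ⟨Set.univ, univ_mem, hU.integrableOn⟩
  have h₃ := IntegrableAtFilter.eq_zero_of_tendsto h₂ (fun s hs => by
    rcases mem_atTop_sets.1 hs with ⟨b, hb⟩
    rw [← top_le_iff, ← Real.volume_Ici (a := b)]
    exact measure_mono hb) h₁
  rwa [h₃] at h₁

theorem tendsto_atBot (h : IsPrimitive U v) (hU : Integrable U) (hv : Integrable v) :
    Tendsto U atBot (𝓝 0) := by
  have h₁ : Tendsto U atBot (𝓝 (U 0 - ∫ x in Set.Iic 0, v x)) := by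
    have e : U = fun x => U 0 - ∫ y in x..(0 : ℝ), v y := by
      funext x
      rw [h.2]
      ring
    refine Tendsto.congr (fun x => (congrFun e x).symm) ?_
    exact (intervalIntegral_tendsto_integral_Iic 0 hv.integrableOn tendsto_id).const_sub _
  have h₂ : IntegrableAtFilter U atBot := ⟨Set.univ, univ_mem, hU.integrableOn⟩
  have h₃ := IntegrableAtFilter.eq_zero_of_tendsto h₂ (fun s hs => by
    rcases mem_atBot_sets.1 hs with ⟨b, hb⟩
    rw [← top_le_iff, ← Real.volume_Iic (a := b)]
    exact measure_mono hb) h₁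
  rwa [h₃] at h₁

theorem integral_eq_zero (h : IsPrimitive U v) (hU : Integrable U) (hv : Integrable v) :
    ∫ x, v x = 0 := by
  have h₁ := intervalIntegral_tendsto_integral hv tendsto_neg_atTop_atBot tendsto_id
  have h₂ : Tendsto (fun x => U x - U (-x)) atTop (𝓝 (0 - 0)) :=
    (h.tendsto_atTop hU hv).sub ((h.tendsto_atBot hU hv).comp tendsto_neg_atTop_atBot)
  refine (tendsto_nhds_unique h₁ ?_).trans (sub_zero 0)
  refine h₂.congr fun x => ?_
  rw [h.2]
  rfl

end IsPrimitive

/-! ## Weak derivatives and primitives -/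

/-- The du Bois-Reymond lemma. For a bump `η` of integral one, `ψ - (∫ ψ) η` has integral zero and
is therefore the derivative of a test function. Hence `∫ f ψ = (∫ f η) (∫ ψ)` for every test
function `ψ`, and the constant is `∫ f η`. -/
theorem ae_eq_const_of_integral_mul_deriv_eq_zero {f : ℝ → ℝ} (hf : LocallyIntegrable f volume)
    (h : ∀ φ : ℝ → ℝ, ContDiff ℝ ∞ φ → HasCompactSupport φ → ∫ x, f x * deriv φ x = 0) :
    ∃ c : ℝ, f =ᵐ[volume] fun _ => c := by
  have hint : ∀ ψ : ℝ → ℝ, Continuous ψ → HasCompactSupport ψ →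
      Integrable (fun x => f x * ψ x) volume := fun ψ hψ hc => by
    simpa [smul_eq_mul, mul_comm] using hf.integrable_smul_left_of_hasCompactSupport hψ hc
  let B : ContDiffBump (0 : ℝ) := ⟨1, 2, one_pos, by norm_num⟩
  set η : ℝ → ℝ := B.normed volume with hη
  have η1 : ContDiff ℝ ∞ η := B.contDiff_normed
  have η2 : HasCompactSupport η := B.hasCompactSupport_normed
  have η3 : ∫ x, η x = 1 := B.integral_normed
  refine ⟨∫ x, f x * η x, ae_eq_of_integral_contDiff_smul_eq hf
    (locallyIntegrable_const _) fun ψ hψ hc => ?_⟩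
  set g : ℝ → ℝ := fun x => ψ x - (∫ y, ψ y) * η x with hg
  have g1 : ContDiff ℝ ∞ g := hψ.sub (contDiff_const.mul η1)
  have g2 : HasCompactSupport g := hc.sub η2.mul_left
  have ig : Integrable g := g1.continuous.integrable_of_hasCompactSupport g2
  have g3 : ∫ x, g x = 0 := by
    rw [hg, integral_sub (hψ.continuous.integrable_of_hasCompactSupport hc)
      ((η1.continuous.integrable_of_hasCompactSupport η2).const_mul _), integral_const_mul, η3]
    ring
  obtain ⟨M, hM⟩ : ∃ M : ℝ, ∀ x, M ≤ |x| → g x = 0 := by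
    obtain ⟨M, hM⟩ := g2.isCompact.isBounded.exists_norm_le
    refine ⟨M + 1, fun x hx => ?_⟩
    by_contra hne
    have := hM x (subset_tsupport g hne)
    rw [Real.norm_eq_abs] at this
    linarith
  set φ : ℝ → ℝ := fun x => ∫ y in Set.Iic x, g y with hφ
  have φd : ∀ x, HasDerivAt φ (g x) x := by
    intro x
    have e : φ = fun x => (∫ y in Set.Iic 0, g y) + ∫ y in (0 : ℝ)..x, g y := by
      funext x
      rw [← intervalIntegral.integral_Iic_sub_Iic ig.integrableOn ig.integrableOn]
      ring
    rw [e]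
    exact (intervalIntegral.integral_hasDerivAt_right (g1.continuous.intervalIntegrable _ _)
      g1.continuous.stronglyMeasurable.stronglyMeasurableAtFilter
      g1.continuous.continuousAt).const_add _
  have φ1 : ContDiff ℝ ∞ φ := by
    rw [contDiff_infty_iff_deriv]
    refine ⟨fun x => (φd x).differentiableAt, ?_⟩
    rw [show deriv φ = g from funext fun x => (φd x).deriv]
    exact g1
  have φ2 : HasCompactSupport φ := by
    refine HasCompactSupport.of_support_subset_isCompact (isCompact_Icc (a := -M) (b := M)) ?_
    intro x hx
    by_contra hne
    refine hx ?_
    rw [Set.mem_Icc, not_and_or, not_le, not_le] at hne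
    rcases hne with hlt | hlt
    · refine setIntegral_eq_zero_of_forall_eq_zero fun y hy => hM y ?_
      rw [Set.mem_Iic] at hy
      exact (by linarith : M ≤ -y).trans (neg_le_abs y)
    · rw [hφ, ← g3]
      refine setIntegral_eq_integral_of_forall_compl_eq_zero fun y hy => hM y ?_
      rw [Set.mem_Iic, not_le] at hy
      exact (by linarith : M ≤ y).trans (le_abs_self y)
  have key := h φ φ1 φ2
  rw [show deriv φ = g from funext fun x => (φd x).deriv] at key
  have e : ∀ x, f x * g x = f x * ψ x - (∫ y, ψ y) * (f x * η x) := fun x => by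
    rw [hg]
    ring
  simp_rw [e] at key
  rw [integral_sub (hint ψ hψ.continuous hc) ((hint η η1.continuous η2).const_mul _),
    integral_const_mul, sub_eq_zero] at key
  simp only [smul_eq_mul]
  rw [integral_mul_const, ← key]
  simp_rw [mul_comm]

theorem IsPrimitive.integral_mul_deriv {U v : ℝ → ℝ} (h : IsPrimitive U v) {φ : ℝ → ℝ}
    (hφ : ContDiff ℝ ∞ φ) (hc : HasCompactSupport φ) :
    ∫ x, U x * deriv φ x = -∫ x, v x * φ x := by
  have hd : Continuous (deriv φ) := hφ.continuous_deriv (by simp)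
  have hp : IsPrimitive φ (deriv φ) := IsPrimitive.of_hasDerivAt
    (fun x => (hφ.differentiable (by simp) x).hasDerivAt) hd
  have i₁ : Integrable (fun x => U x * deriv φ x) :=
    (h.continuous.mul hd).integrable_of_hasCompactSupport hc.deriv.mul_left
  have i₂ : Integrable (fun x => v x * φ x) := by
    simpa [smul_eq_mul, mul_comm] using
      h.1.integrable_smul_left_of_hasCompactSupport hφ.continuous hc
  have i₃ : Integrable (fun x => U x * φ x) :=
    (h.continuous.mul hφ.continuous).integrable_of_hasCompactSupport hc.mul_left
  have := (h.mul hp).integral_eq_zero i₃ (i₂.add i₁)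
  rw [integral_add i₂ i₁] at this
  linarith

/-- The difference of `u` and a primitive of `v` has weak derivative zero. Pointwise evaluation,
needed for the Dirichlet conditions, rests on this continuous representative. -/
theorem HasWeakDeriv.exists_isPrimitive {u v : L2R} (h : HasWeakDeriv u v) :
    ∃ U : ℝ → ℝ, U =ᵐ[volume] u ∧ IsPrimitive U v := by
  have hv := L2R.locallyIntegrable v
  have hP : IsPrimitive (fun x => ∫ y in (0 : ℝ)..x, v y) v := ⟨hv, fun a b => by
    have hi : ∀ a b : ℝ, IntervalIntegrable v volume a b := fun a b =>
      (hv.integrableOn_isCompact isCompact_uIcc).intervalIntegrable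
    exact (intervalIntegral.integral_interval_sub_left (hi 0 b) (hi 0 a)).symm⟩
  set P : ℝ → ℝ := fun x => ∫ y in (0 : ℝ)..x, v y with hPdef
  obtain ⟨c, hc⟩ := ae_eq_const_of_integral_mul_deriv_eq_zero (f := fun x => u x - P x)
    ((L2R.locallyIntegrable u).sub hP.continuous.locallyIntegrable) (fun φ hφ hs => by
      have hd : Continuous (deriv φ) := hφ.continuous_deriv (by simp)
      simp_rw [sub_mul]
      have i₂ : Integrable (fun x => P x * deriv φ x) :=
        (hP.continuous.mul hd).integrable_of_hasCompactSupport hs.deriv.mul_left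
      rw [integral_sub (L2R.integrable_mul u hd hs.deriv) i₂,
        h φ hφ hs, hP.integral_mul_deriv hφ hs, sub_self])
  refine ⟨fun x => P x + c, ?_, hv, fun a b => ?_⟩
  · filter_upwards [hc] with x hx
    linarith
  · rw [hP.2]
    ring

theorem IsPrimitive.hasWeakDeriv {u v : L2R} {U : ℝ → ℝ} (h : IsPrimitive U v)
    (hU : U =ᵐ[volume] u) : HasWeakDeriv u v := by
  intro φ hφ hc
  rw [← h.integral_mul_deriv hφ hc]
  refine integral_congr_ae ?_
  filter_upwards [hU] with x hx
  rw [hx]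

theorem L2R.integrable_mul_mul (u v : L2R) : Integrable (fun x => u x * v x) volume :=
  (Lp.memLp u).integrable_mul (Lp.memLp v)

theorem L2R.inner_eq (u v : L2R) : inner ℝ u v = ∫ x, u x * v x := by
  rw [L2.inner_def]
  refine integral_congr_ae (Eventually.of_forall fun x => ?_)
  simp [mul_comm]

/-- The product of the continuous representatives is integrable with integrable derivative, so that
derivative has integral zero. No density of test functions is needed. -/
theorem HasWeakDeriv.inner_eq_neg {u u' v v' : L2R} (hu : HasWeakDeriv u u')
    (hv : HasWeakDeriv v v') : inner ℝ u' v = -inner ℝ u v' := by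
  obtain ⟨U, hU, pU⟩ := hu.exists_isPrimitive
  obtain ⟨V, hV, pV⟩ := hv.exists_isPrimitive
  have i₁ := L2R.integrable_mul_mul u v
  have i₂ := L2R.integrable_mul_mul u' v
  have i₃ := L2R.integrable_mul_mul u v'
  have e₁ : (fun x => u x * v x) =ᵐ[volume] fun x => U x * V x := by
    filter_upwards [hU, hV] with x h₁ h₂
    rw [h₁, h₂]
  have e₂ : (fun x => u' x * v x) =ᵐ[volume] fun x => u' x * V x := by
    filter_upwards [hV] with x h₂
    rw [h₂]
  have e₃ : (fun x => u x * v' x) =ᵐ[volume] fun x => U x * v' x := by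
    filter_upwards [hU] with x h₂
    rw [h₂]
  have := (pU.mul pV).integral_eq_zero (i₁.congr e₁) ((i₂.congr e₂).add (i₃.congr e₃))
  rw [integral_add (i₂.congr e₂) (i₃.congr e₃), ← integral_congr_ae e₂,
    ← integral_congr_ae e₃] at this
  rw [L2R.inner_eq, L2R.inner_eq]
  linarith

/-! ## The profile of the pulse -/

/-- The profile `u = 1 / (1 + √ν cosh 2x)`, proportional to `r²`. -/
def prof (ν x : ℝ) : ℝ := 1 / (1 + √ν * Real.cosh (2 * x))

/-- `tanh 2x`. -/
def tanhTwo (x : ℝ) : ℝ := Real.sinh (2 * x) / Real.cosh (2 * x)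

/-- `1 / cosh 2x`. -/
def sechTwo (x : ℝ) : ℝ := 1 / Real.cosh (2 * x)

theorem hasDerivAt_cosh_two_mul (x : ℝ) :
    HasDerivAt (fun y => Real.cosh (2 * y)) (Real.sinh (2 * x) * 2) x :=
  (Real.hasDerivAt_cosh (2 * x)).comp x (by simpa using (hasDerivAt_id x).const_mul 2)

theorem hasDerivAt_sinh_two_mul (x : ℝ) :
    HasDerivAt (fun y => Real.sinh (2 * y)) (Real.cosh (2 * x) * 2) x :=
  (Real.hasDerivAt_sinh (2 * x)).comp x (by simpa using (hasDerivAt_id x).const_mul 2)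

theorem tanhTwo_sq (x : ℝ) : tanhTwo x ^ 2 = 1 - sechTwo x ^ 2 := by
  have h := Real.cosh_pos (2 * x)
  have h₁ := Real.sinh_sq (2 * x)
  unfold tanhTwo sechTwo
  field_simp
  linarith

theorem sechTwo_pos (x : ℝ) : 0 < sechTwo x := one_div_pos.2 (Real.cosh_pos _)

theorem sechTwo_le_one (x : ℝ) : sechTwo x ≤ 1 := by
  unfold sechTwo
  rw [div_le_one (Real.cosh_pos _)]
  exact Real.one_le_cosh _

theorem abs_tanhTwo_le_one (x : ℝ) : |tanhTwo x| ≤ 1 := by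
  rw [← sq_le_one_iff_abs_le_one, tanhTwo_sq]
  have := sq_nonneg (sechTwo x)
  linarith

theorem hasDerivAt_tanhTwo (x : ℝ) : HasDerivAt tanhTwo (2 * (1 - tanhTwo x ^ 2)) x := by
  have h := (Real.cosh_pos (2 * x)).ne'
  refine ((hasDerivAt_sinh_two_mul x).div (hasDerivAt_cosh_two_mul x) h).congr_deriv ?_
  unfold tanhTwo
  field_simp

theorem continuous_tanhTwo : Continuous tanhTwo :=
  continuous_iff_continuousAt.2 fun x => (hasDerivAt_tanhTwo x).continuousAt

theorem continuous_sechTwo : Continuous sechTwo := by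
  unfold sechTwo
  exact Continuous.div continuous_const (by fun_prop) fun x => (Real.cosh_pos _).ne'

theorem prof_pos (ν x : ℝ) : 0 < prof ν x :=
  one_div_pos.2 (zero_lt_one.trans_le (one_le_denom ν x))

theorem prof_le_one (ν x : ℝ) : prof ν x ≤ 1 := by
  unfold prof
  rw [div_le_one (zero_lt_one.trans_le (one_le_denom ν x))]
  exact one_le_denom ν x

theorem one_sub_prof_mul (ν x : ℝ) : (1 - prof ν x) * sechTwo x = √ν * prof ν x := by
  have h := (Real.cosh_pos (2 * x)).ne'
  have h₁ := (zero_lt_one.trans_le (one_le_denom ν x)).ne'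
  unfold prof sechTwo
  field_simp
  ring

theorem hasDerivAt_prof (ν x : ℝ) :
    HasDerivAt (prof ν) (-2 * tanhTwo x * prof ν x * (1 - prof ν x)) x := by
  have h := (Real.cosh_pos (2 * x)).ne'
  have h₁ := (zero_lt_one.trans_le (one_le_denom ν x)).ne'
  refine ((hasDerivAt_const x (1 : ℝ)).div
    (((hasDerivAt_cosh_two_mul x).const_mul √ν).const_add 1) h₁).congr_deriv ?_
  unfold tanhTwo prof
  field_simp
  ring

theorem continuous_prof (ν : ℝ) : Continuous (prof ν) :=
  continuous_iff_continuousAt.2 fun x => (hasDerivAt_prof ν x).continuousAt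

theorem prof_neg (ν x : ℝ) : prof ν (-x) = prof ν x := by simp [prof]

theorem prof_le_prof {ν x y : ℝ} (h : |x| ≤ |y|) : prof ν y ≤ prof ν x := by
  unfold prof
  refine one_div_le_one_div_of_le (zero_lt_one.trans_le (one_le_denom ν x)) ?_
  have : Real.cosh (2 * x) ≤ Real.cosh (2 * y) := by
    rw [Real.cosh_le_cosh, abs_mul, abs_mul]
    gcongr
  gcongr

theorem exists_prof_eq {ν : ℝ} (h0 : 0 < ν) (h1 : ν ≤ 1) : ∃ x, 0 ≤ x ∧ prof ν x = 1 / 3 := by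
  have hs : 0 < √ν := Real.sqrt_pos.2 h0
  have hs1 : √ν ≤ 1 := Real.sqrt_le_one.2 h1
  have hc : Continuous fun x : ℝ => Real.cosh x := Real.continuous_cosh
  have h2 : (1 : ℝ) ≤ 2 / √ν := by rw [le_div_iff₀ hs]; linarith
  -- The equation `u = 1/3` means `√ν cosh 2x = 2`. The right endpoint is large enough because `cosh
  -- y ≥ (y + 1) / 2`.
  obtain ⟨y, hy, e⟩ := intermediate_value_Icc (f := Real.cosh) (a := 0) (b := 2 * (2 / √ν))
    (by positivity) hc.continuousOn (show 2 / √ν ∈ Set.Icc _ _ by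
      rw [Real.cosh_zero]
      refine ⟨h2, ?_⟩
      have e₁ := Real.add_one_le_exp (2 * (2 / √ν))
      have e₂ := Real.exp_pos (-(2 * (2 / √ν)))
      rw [Real.cosh_eq]
      linarith)
  refine ⟨y / 2, by linarith [hy.1], ?_⟩
  unfold prof
  rw [show 2 * (y / 2) = y by ring, e]
  field_simp
  norm_num

/-- The potential divided by the mass. -/
def scaledPot (ν x : ℝ) : ℝ := 1 - 12 * prof ν x + 15 * (1 - ν) * prof ν x ^ 2

theorem continuous_scaledPot (ν : ℝ) : Continuous (scaledPot ν) := by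
  have := continuous_prof ν
  unfold scaledPot
  fun_prop

/-! ## A lower bound under Dirichlet conditions -/

/-- The derivative of `h W²` is `h' W² + 2 h W w`. It is at most the integrand because `(w - h W)² ≥
0`. A Riccati subsolution thus plays the role of the logarithmic derivative of a positive
supersolution. -/
theorem IsPrimitive.riccati {W w h h' : ℝ → ℝ} (hW : IsPrimitive W w)
    (hw : LocallyIntegrable (fun x => w x ^ 2) volume) (hh : ∀ x, HasDerivAt h (h' x) x)
    (hc : Continuous h') {q : ℝ → ℝ} (hq : Continuous q) {κ a b : ℝ} (hab : a ≤ b)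
    (hle : ∀ x ∈ Set.Icc a b, h' x + h x ^ 2 + κ ≤ q x) :
    h b * W b ^ 2 - h a * W a ^ 2 ≤ ∫ x in a..b, (w x ^ 2 + (q x - κ) * W x ^ 2) := by
  have hp : IsPrimitive h h' := .of_hasDerivAt hh hc
  have hP := hp.mul (hW.mul hW)
  have iw : IntervalIntegrable (fun x => w x ^ 2) volume a b :=
    (hw.integrableOn_isCompact isCompact_uIcc).intervalIntegrable
  have ic : IntervalIntegrable (fun x => (q x - κ) * W x ^ 2) volume a b := by
    have := hW.continuous
    exact Continuous.intervalIntegrable (by fun_prop) _ _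
  have e : h b * W b ^ 2 - h a * W a ^ 2 = h b * (W b * W b) - h a * (W a * W a) := by ring
  rw [e, ← hP.2 a b]
  refine intervalIntegral.integral_mono_on hab (hP.intervalIntegrable a b) (iw.add ic)
    fun x hx => ?_
  have h₁ := hle x hx
  have h₂ := mul_le_mul_of_nonneg_right h₁ (sq_nonneg (W x))
  have h₃ := sq_nonneg (w x - h x * W x)
  linarith

/-- Outside the nodes `1 - u ≥ 2/3`, so `sech 2x = √ν u / (1 - u)` is small and `tanh² 2x` is nearly
one. Up to small errors the claim is a quadratic inequality on `0 < u ≤ 1/3`; the coefficients 17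
and 3 leave a margin of `1/10` there. -/
theorem riccati_outer {ν x : ℝ} (h0 : 0 < ν) (h1 : √ν ≤ 1 / 1000) (hx : prof ν x ≤ 1 / 3) :
    2 * (1 - tanhTwo x ^ 2) * ((17 * prof ν x - 3) / 4) +
      tanhTwo x * (17 / 4 * (-2 * tanhTwo x * prof ν x * (1 - prof ν x))) +
      (tanhTwo x * ((17 * prof ν x - 3) / 4)) ^ 2 + 1 / 50 ≤ scaledPot ν x := by
  have hz := tanhTwo_sq x
  have hr := one_sub_prof_mul ν x
  have hz0 := sechTwo_pos x
  have hu0 := prof_pos ν x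
  have hν := Real.sq_sqrt h0.le
  have hs0 := Real.sqrt_pos.2 h0
  unfold scaledPot
  generalize prof ν x = u at *
  generalize sechTwo x = z at *
  generalize tanhTwo x = t at *
  generalize √ν = s at *
  subst hν
  have hz1 : z ≤ 1 / 1000 := by nlinarith
  have hz2 : z ^ 2 ≤ 1 / 1000 := by nlinarith
  have hs2 : s ^ 2 ≤ 1 / 1000 := by nlinarith
  have e : 2 * (1 - t ^ 2) * ((17 * u - 3) / 4) + t * (17 / 4 * (-2 * t * u * (1 - u))) +
      (t * ((17 * u - 3) / 4)) ^ 2 = 2 * z ^ 2 * ((17 * u - 3) / 4)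
      + (1 - z ^ 2) * (-17 / 2 * u * (1 - u) + ((17 * u - 3) / 4) ^ 2) := by
    linear_combination (-2 * ((17 * u - 3) / 4) - 17 / 2 * u * (1 - u) +
      ((17 * u - 3) / 4) ^ 2) * hz
  rw [e]
  have hb : 1 / 10 ≤ 1 - 12 * u + 15 * u ^ 2 + 17 / 2 * u * (1 - u) - ((17 * u - 3) / 4) ^ 2 := by
    nlinarith
  have hc : 2 * ((17 * u - 3) / 4) + 17 / 2 * u * (1 - u) - ((17 * u - 3) / 4) ^ 2 ≤ 10 := by
    nlinarith
  have hc' := mul_le_mul_of_nonneg_left hc (sq_nonneg z)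
  have hd : s ^ 2 * u ^ 2 ≤ 1 / 1000 := by nlinarith
  linarith

/-- Inside, `z = sech 2x` need not be small, but then `1 - u` is, since `(1 - u) z = √ν u`. The
required inequality is a combination, with weights `1 - z²` and `z²`, of a quadratic inequality on
`1/3 ≤ u ≤ 1` and of its value near `u = 1`. -/
theorem riccati_inner {ν x : ℝ} (h0 : 0 < ν) (h1 : √ν ≤ 1 / 1000) (hx : 1 / 3 ≤ prof ν x) :
    2 * (1 - tanhTwo x ^ 2) * ((34 * prof ν x - 15) / 10) +
      tanhTwo x * (34 / 10 * (-2 * tanhTwo x * prof ν x * (1 - prof ν x))) +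
      (tanhTwo x * ((34 * prof ν x - 15) / 10)) ^ 2 + 1 / 50 ≤ scaledPot ν x := by
  have hz := tanhTwo_sq x
  have hr := one_sub_prof_mul ν x
  have hz0 := sechTwo_pos x
  have hz1 := sechTwo_le_one x
  have hu0 := prof_pos ν x
  have hu1 := prof_le_one ν x
  have hν := Real.sq_sqrt h0.le
  have hs0 := Real.sqrt_pos.2 h0
  unfold scaledPot
  generalize prof ν x = u at *
  generalize sechTwo x = z at *
  generalize tanhTwo x = t at *
  generalize √ν = s at *
  subst hν
  have e : 2 * (1 - t ^ 2) * ((34 * u - 15) / 10) + t * (34 / 10 * (-2 * t * u * (1 - u))) +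
      (t * ((34 * u - 15) / 10)) ^ 2 = 2 * z ^ 2 * ((34 * u - 15) / 10)
      + (1 - z ^ 2) * (-34 / 5 * u * (1 - u) + ((34 * u - 15) / 10) ^ 2) := by
    linear_combination (-2 * ((34 * u - 15) / 10) - 34 / 5 * u * (1 - u) +
      ((34 * u - 15) / 10) ^ 2) * hz
  rw [e]
  have hb : 43 / 1000 ≤
      1 - 12 * u + 15 * u ^ 2 + 34 / 5 * u * (1 - u) - ((34 * u - 15) / 10) ^ 2 := by
    nlinarith
  have hz2 : z ^ 2 ≤ 1 := by nlinarith
  have hb' := mul_le_mul_of_nonneg_left hb (sub_nonneg.2 hz2)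
  have hs2 : s ^ 2 ≤ 1 / 100000 := by nlinarith
  have hd : s ^ 2 * u ^ 2 ≤ 1 / 100000 := by
    have : u ^ 2 ≤ 1 := pow_le_one₀ hu0.le hu1
    nlinarith [sq_nonneg s]
  -- At `ν = 0` the part weighted by `z²` is `1/5 - (1 - u) (15 u - 19/5)`. Its negative term is
  -- controlled because `z² (1 - u) = z √ν u`.
  have hzz : z ^ 2 * (1 - u) ≤ 1 / 1000 := by
    have e₁ : z ^ 2 * (1 - u) = z * (s * u) := by linear_combination z * hr
    rw [e₁]
    calc z * (s * u) ≤ 1 * (1 / 1000 * 1) := by gcongr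
      _ = 1 / 1000 := by norm_num
  have hza : z ^ 2 * (1 - u) * (56 / 5) ≥ z ^ 2 * (1 - u) * (15 * u - 19 / 5) :=
    mul_le_mul_of_nonneg_left (by linarith) (by have := sub_nonneg.2 hu1; positivity)
  linarith [sq_nonneg z]

/-- The Riccati function may jump at `±x₀` because `W` vanishes there and the boundary terms drop
out. This freedom allows a strictly positive bound although `A` itself has a kernel and a negative
eigenvalue. -/
theorem dirichlet_bound {ν : ℝ} (h0 : 0 < ν) (h1 : √ν ≤ 1 / 1000) {x₀ : ℝ} (hx₀ : 0 ≤ x₀)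
    (hp : prof ν x₀ = 1 / 3) {W w : ℝ → ℝ} (hW : IsPrimitive W w)
    (iW : Integrable fun x => W x ^ 2) (iw : Integrable fun x => w x ^ 2)
    (iWw : Integrable fun x => W x * w x) (hr : W x₀ = 0) (hl : W (-x₀) = 0) :
    0 ≤ ∫ x, (w x ^ 2 + (scaledPot ν x - 1 / 50) * W x ^ 2) := by
  have hu := hasDerivAt_prof ν
  have cu := continuous_prof ν
  have ct := continuous_tanhTwo
  have cq := continuous_scaledPot ν
  have iq : Integrable fun x => w x ^ 2 + (scaledPot ν x - 1 / 50) * W x ^ 2 := by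
    refine iw.add (iW.bdd_mul (c := 30) (by fun_prop) (Eventually.of_forall fun x => ?_))
    have p0 := prof_pos ν x
    have p1 := prof_le_one ν x
    have hν := Real.sq_sqrt h0.le
    have hs0 := Real.sqrt_pos.2 h0
    have hs : ν ≤ 1 := by nlinarith
    have a₁ : prof ν x ^ 2 ≤ 1 := by nlinarith
    rw [Real.norm_eq_abs, abs_le, scaledPot]
    constructor <;> nlinarith [mul_nonneg (sub_nonneg.2 hs) (sq_nonneg (prof ν x))]
  set ho : ℝ → ℝ := fun x => tanhTwo x * ((17 * prof ν x - 3) / 4) with hho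
  have hod : ∀ x, HasDerivAt ho (2 * (1 - tanhTwo x ^ 2) * ((17 * prof ν x - 3) / 4) +
      tanhTwo x * (17 / 4 * (-2 * tanhTwo x * prof ν x * (1 - prof ν x)))) x := fun x =>
    ((hasDerivAt_tanhTwo x).mul
      ((((hu x).const_mul 17).sub_const 3).div_const 4)).congr_deriv (by ring)
  set hi : ℝ → ℝ := fun x => tanhTwo x * ((34 * prof ν x - 15) / 10) with hhi
  have hid : ∀ x, HasDerivAt hi (2 * (1 - tanhTwo x ^ 2) * ((34 * prof ν x - 15) / 10) +
      tanhTwo x * (34 / 10 * (-2 * tanhTwo x * prof ν x * (1 - prof ν x)))) x := fun x =>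
    ((hasDerivAt_tanhTwo x).mul
      ((((hu x).const_mul 34).sub_const 15).div_const 10)).congr_deriv (by ring)
  -- The boundary terms at infinity vanish: the Riccati function is bounded, and `W²` is integrable
  -- with integrable derivative.
  have hlim : Tendsto (fun b => ho b * W b ^ 2 - ho (-b) * W (-b) ^ 2) atTop (𝓝 0) := by
    have hP := hW.mul hW
    have i₁ : Integrable fun x => W x * W x := iW.congr (by simp [sq])
    have i₂ : Integrable fun x => w x * W x + W x * w x :=
      (iWw.congr (by simp [mul_comm])).add iWw
    have t₁ := hP.tendsto_atTop i₁ i₂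
    have t₂ := (hP.tendsto_atBot i₁ i₂).comp tendsto_neg_atTop_atBot
    have hob : ∀ x, |ho x| ≤ 5 := fun x => by
      have p0 := prof_pos ν x
      have p1 := prof_le_one ν x
      change |tanhTwo x * ((17 * prof ν x - 3) / 4)| ≤ 5
      rw [abs_mul]
      have := abs_tanhTwo_le_one x
      have h₂ : |(17 * prof ν x - 3) / 4| ≤ 5 := by
        rw [abs_le]
        constructor <;> linarith
      nlinarith [abs_nonneg (tanhTwo x), abs_nonneg ((17 * prof ν x - 3) / 4)]
    refine squeeze_zero_norm (a := fun b => 5 * (W b * W b) + 5 * (W (-b) * W (-b)))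
      (fun b => ?_) (by simpa using (t₁.const_mul 5).add (t₂.const_mul 5))
    rw [Real.norm_eq_abs]
    refine (abs_sub _ _).trans ?_
    rw [abs_mul (ho b), abs_mul (ho (-b)), abs_of_nonneg (sq_nonneg (W b)),
      abs_of_nonneg (sq_nonneg (W (-b))), sq, sq]
    exact add_le_add (mul_le_mul_of_nonneg_right (hob b) (mul_self_nonneg _))
      (mul_le_mul_of_nonneg_right (hob (-b)) (mul_self_nonneg _))
  refine le_of_tendsto_of_tendsto hlim
    (intervalIntegral_tendsto_integral iq tendsto_neg_atTop_atBot tendsto_id) ?_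
  filter_upwards [eventually_ge_atTop x₀] with b hb
  have hii : ∀ a b : ℝ, IntervalIntegrable
      (fun x => w x ^ 2 + (scaledPot ν x - 1 / 50) * W x ^ 2) volume a b :=
    fun a b => iq.intervalIntegrable
  have h₁ := hW.riccati iw.locallyIntegrable hod (by fun_prop) cq (κ := 1 / 50)
    (a := -b) (b := -x₀) (by linarith) (fun x hx => riccati_outer h0 h1 (by
      rw [← hp]
      exact prof_le_prof (by
        rw [abs_of_nonneg hx₀, abs_of_nonpos (by linarith [hx.2])]
        linarith [hx.2])))
  have h₂ := hW.riccati iw.locallyIntegrable hid (by fun_prop) cq (κ := 1 / 50)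
    (a := -x₀) (b := x₀) (by linarith) (fun x hx => riccati_inner h0 h1 (by
      rw [← hp]
      exact prof_le_prof (by
        rw [abs_of_nonneg hx₀, abs_le]
        exact hx)))
  have h₃ := hW.riccati iw.locallyIntegrable hod (by fun_prop) cq (κ := 1 / 50)
    (a := x₀) (b := b) hb (fun x hx => riccati_outer h0 h1 (by
      rw [← hp]
      exact prof_le_prof (by
        rw [abs_of_nonneg hx₀, abs_of_nonneg (hx₀.trans hx.1)]
        exact hx.1)))
  rw [id, ← intervalIntegral.integral_add_adjacent_intervals (hii (-b) x₀) (hii x₀ b),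
    ← intervalIntegral.integral_add_adjacent_intervals (hii (-b) (-x₀)) (hii (-x₀) x₀)]
  rw [hr, hl] at *
  linarith

/-! ## Integrals of the profile -/

theorem sechTwo_le (x : ℝ) : sechTwo x ≤ 2 * Real.exp (-2 * |x|) := by
  have h : Real.exp (2 * |x|) / 2 ≤ Real.cosh (2 * x) := by
    rw [← Real.cosh_abs, abs_mul, abs_two, Real.cosh_eq]
    have := Real.exp_pos (-(2 * |x|))
    linarith
  unfold sechTwo
  rw [div_le_iff₀ (Real.cosh_pos _)]
  have h₁ := mul_le_mul_of_nonneg_left h (Real.exp_pos (-2 * |x|)).le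
  have h₂ : Real.exp (-2 * |x|) * Real.exp (2 * |x|) = 1 := by
    rw [← Real.exp_add]
    simp
  linarith

theorem integrable_exp_neg_two_mul_abs : Integrable fun x : ℝ => Real.exp (-2 * |x|) := by
  have h := integral_comp_abs (f := fun x => Real.exp (-2 * x))
  rw [integral_exp_mul_Ioi (by norm_num)] at h
  -- A nonintegrable function would have integral zero by convention, contrary to the value just
  -- computed.
  by_contra hn
  rw [integral_undef hn] at h
  norm_num at h

theorem integral_exp_neg_two_mul_abs : ∫ x : ℝ, Real.exp (-2 * |x|) = 1 := by
  have h := integral_comp_abs (f := fun x => Real.exp (-2 * x))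
  rw [h, integral_exp_mul_Ioi (by norm_num)]
  norm_num

theorem integrable_sechTwo : Integrable sechTwo := by
  refine (integrable_exp_neg_two_mul_abs.const_mul 2).mono' continuous_sechTwo.aestronglyMeasurable
    (Eventually.of_forall fun x => ?_)
  rw [Real.norm_of_nonneg (sechTwo_pos x).le]
  exact sechTwo_le x

theorem integral_sechTwo_le : ∫ x, sechTwo x ≤ 2 := by
  refine (integral_mono integrable_sechTwo (integrable_exp_neg_two_mul_abs.const_mul 2)
    sechTwo_le).trans ?_
  rw [integral_const_mul, integral_exp_neg_two_mul_abs]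
  norm_num

theorem integrable_sechTwo_sq : Integrable fun x => sechTwo x ^ 2 := by
  refine integrable_sechTwo.mono' (continuous_sechTwo.pow 2).aestronglyMeasurable
    (Eventually.of_forall fun x => ?_)
  rw [Real.norm_of_nonneg (sq_nonneg _), sq]
  exact mul_le_of_le_one_left (sechTwo_pos x).le (sechTwo_le_one x)

theorem tendsto_tanhTwo_atTop : Tendsto tanhTwo atTop (𝓝 1) := by
  have h : Tendsto (fun x : ℝ => 1 - Real.exp (-(2 * x))) atTop (𝓝 (1 - 0)) :=
    ((Real.tendsto_exp_neg_atTop_nhds_zero).comp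
      (tendsto_id.const_mul_atTop (by norm_num : (0 : ℝ) < 2))).const_sub 1
  rw [sub_zero] at h
  refine tendsto_of_tendsto_of_tendsto_of_le_of_le h tendsto_const_nhds (fun x => ?_)
    fun x => (abs_le.1 (abs_tanhTwo_le_one x)).2
  have e := Real.cosh_sub_sinh (2 * x)
  have hc := Real.one_le_cosh (2 * x)
  have he := Real.exp_pos (-(2 * x))
  unfold tanhTwo
  beta_reduce
  rw [le_div_iff₀ (by linarith)]
  nlinarith

theorem integral_sechTwo_sq : ∫ x, sechTwo x ^ 2 = 1 := by
  have h : ∀ x, sechTwo |x| ^ 2 = sechTwo x ^ 2 := fun x => by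
    have : Real.cosh (2 * |x|) = Real.cosh (2 * x) := by
      rw [← Real.cosh_abs (2 * x), abs_mul, abs_two]
    rw [sechTwo, sechTwo, this]
  have h₁ := integral_comp_abs (f := fun x => sechTwo x ^ 2)
  simp only [h] at h₁
  rw [h₁, integral_Ioi_of_hasDerivAt_of_tendsto' (f := fun x => tanhTwo x / 2)
    (fun x _ => ((hasDerivAt_tanhTwo x).div_const 2).congr_deriv (by rw [tanhTwo_sq]; ring))
    integrable_sechTwo_sq.integrableOn (tendsto_tanhTwo_atTop.div_const 2)]
  simp [tanhTwo]

variable {ν : ℝ}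

theorem prof_le_sechTwo (h0 : 0 < ν) (x : ℝ) : prof ν x ≤ 1 / √ν * sechTwo x := by
  have h := one_sub_prof_mul ν x
  have hs := Real.sqrt_pos.2 h0
  rw [one_div, inv_mul_eq_div, le_div_iff₀ hs]
  have := mul_pos (prof_pos ν x) (sechTwo_pos x)
  linarith

theorem integrable_prof (h0 : 0 < ν) : Integrable (prof ν) := by
  refine (integrable_sechTwo.const_mul (1 / √ν)).mono' (continuous_prof ν).aestronglyMeasurable
    (Eventually.of_forall fun x => ?_)
  rw [Real.norm_of_nonneg (prof_pos ν x).le]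
  exact prof_le_sechTwo h0 x

theorem sqrt_eq_exp_shelf (h0 : 0 < ν) : √ν = 2 * Real.exp (-2 * shelf ν) := by
  rw [Real.sqrt_eq_iff_mul_self_eq h0.le (by positivity)]
  have : Real.exp (-2 * shelf ν) * Real.exp (-2 * shelf ν) = ν / 4 := by
    rw [← Real.exp_add, shelf, show -2 * (1 / 4 * Real.log (4 / ν)) +
      -2 * (1 / 4 * Real.log (4 / ν)) = -Real.log (4 / ν) by ring, Real.exp_neg,
      Real.exp_log (by positivity), inv_div]
  linarith

theorem shelf_ge (h0 : 0 < ν) (h1 : ν ≤ 1) : 1 / 3 ≤ shelf ν := by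
  have h : Real.log 4 ≤ Real.log (4 / ν) :=
    Real.log_le_log (by norm_num) (by rw [le_div_iff₀ h0]; linarith)
  have h4 : Real.log 4 = 2 * Real.log 2 := by
    rw [show (4 : ℝ) = 2 ^ 2 by norm_num, Real.log_pow]
    norm_num
  have := Real.log_two_gt_d9
  unfold shelf
  linarith

/-- A crude bound, sufficient to absorb the logarithmic factor `L` into half a power of `ν`. -/
theorem shelf_le (h0 : 0 < ν) : shelf ν ≤ 1 / √ν := by
  have hs := Real.sqrt_pos.2 h0
  have h : Real.log (4 / ν) = 2 * Real.log (2 / √ν) := by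
    have : 4 / ν = (2 / √ν) ^ 2 := by
      rw [div_pow, Real.sq_sqrt h0.le]
      norm_num
    rw [this, Real.log_pow]
    norm_num
  have h₂ := Real.log_le_sub_one_of_pos (show 0 < 2 / √ν by positivity)
  have h₃ : 2 / √ν = 2 * (1 / √ν) := by ring
  unfold shelf
  rw [h]
  linarith

/-- On the plateau `0 < x ≤ L` the bound `u ≤ 1` is used. Beyond it `u ≤ (2/√ν) exp(-2x)`, whose
integral over `x > L` is exactly `1/2` because `√ν = 2 exp(-2L)`. -/
theorem integral_prof_le (h0 : 0 < ν) (h1 : ν ≤ 1) : ∫ x, prof ν x ≤ 2 * shelf ν + 1 := by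
  have hs := Real.sqrt_pos.2 h0
  have hL : 0 ≤ shelf ν := (by norm_num : (0 : ℝ) ≤ 1 / 3).trans (shelf_ge h0 h1)
  have h : ∀ x, prof ν |x| = prof ν x := fun x => by
    have : Real.cosh (2 * |x|) = Real.cosh (2 * x) := by
      rw [← Real.cosh_abs (2 * x), abs_mul, abs_two]
    rw [prof, prof, this]
  have h₁ := integral_comp_abs (f := prof ν)
  simp only [h] at h₁
  have i := integrable_prof h0
  rw [h₁, ← Set.Ioc_union_Ioi_eq_Ioi hL, setIntegral_union (Set.Ioc_disjoint_Ioi le_rfl)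
    measurableSet_Ioi i.integrableOn i.integrableOn]
  have h₂ : ∫ x in Set.Ioc 0 (shelf ν), prof ν x ≤ shelf ν := by
    refine (setIntegral_mono_on (g := fun _ => (1 : ℝ)) i.integrableOn (by simp)
      measurableSet_Ioc fun x _ => prof_le_one ν x).trans ?_
    simp [hL]
  have h₃ : ∫ x in Set.Ioi (shelf ν), prof ν x ≤ 1 / 2 := by
    have i₂ := integrableOn_exp_mul_Ioi (show (-2 : ℝ) < 0 by norm_num) (shelf ν)
    refine (setIntegral_mono_on (g := fun x => 2 / √ν * Real.exp (-2 * x)) i.integrableOn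
      (i₂.const_mul _) measurableSet_Ioi fun x hx => ?_).trans ?_
    · have hx' : 0 ≤ x := hL.trans (le_of_lt hx)
      have := sechTwo_le x
      rw [abs_of_nonneg hx'] at this
      calc prof ν x ≤ 1 / √ν * sechTwo x := prof_le_sechTwo h0 x
        _ ≤ 1 / √ν * (2 * Real.exp (-2 * x)) := by gcongr
        _ = _ := by ring
    · rw [integral_const_mul, integral_exp_mul_Ioi (by norm_num)]
      have := sqrt_eq_exp_shelf h0
      rw [show Real.exp (-2 * shelf ν) = √ν / 2 by linarith]
      field_simp
      norm_num
  linarith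

theorem integral_prof_nonneg : 0 ≤ ∫ x, prof ν x :=
  integral_nonneg fun x => (prof_pos ν x).le

theorem integrable_prof_mul (h0 : 0 < ν) {f : ℝ → ℝ} (hf : Continuous f) (c : ℝ)
    (hc : ∀ x, |f x| ≤ c) : Integrable fun x => prof ν x * f x :=
  (integrable_prof h0).mul_bdd hf.aestronglyMeasurable (Eventually.of_forall hc)

/-- The integrals `∫ uᵏ (1 - u)`. -/
def profMoment (ν : ℝ) (k : ℕ) : ℝ := ∫ x, prof ν x ^ k * (1 - prof ν x)

theorem integrable_profMoment (h0 : 0 < ν) (k : ℕ) :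
    Integrable fun x => prof ν x ^ (k + 1) * (1 - prof ν x) := by
  have := continuous_prof ν
  refine (integrable_prof_mul h0 (f := fun x => prof ν x ^ k * (1 - prof ν x)) (by fun_prop) 1
    fun x => ?_).congr (Eventually.of_forall fun x => by ring)
  have p0 := prof_pos ν x
  have p1 := prof_le_one ν x
  rw [abs_of_nonneg (mul_nonneg (by positivity) (by linarith))]
  exact mul_le_one₀ (pow_le_one₀ p0.le p1) (by linarith) (by linarith)

/-- The derivative of `tanh(2x) u^(k+1)` integrates to zero, which writes the moment as an integral
against `sech² 2x`, whose total mass is one. The remaining weight differs from one by at most `(k +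
1) (1 - u)`, and `sech² 2x (1 - u) = √ν u sech 2x`. -/
theorem abs_profMoment_sub_le (h0 : 0 < ν) (k : ℕ) :
    |(k + 1) * profMoment ν (k + 1) - 1| ≤ (k + 1) * (2 * √ν) := by
  have cu := continuous_prof ν
  have ct := continuous_tanhTwo
  have cz := continuous_sechTwo
  have hs := Real.sqrt_nonneg ν
  have hp : IsPrimitive (fun x => tanhTwo x * prof ν x ^ (k + 1)) (fun x =>
      2 * (sechTwo x ^ 2 * (prof ν x ^ (k + 1) +
        (k + 1) * (prof ν x ^ (k + 1) * (1 - prof ν x)))) -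
        2 * ((k + 1) * (prof ν x ^ (k + 1) * (1 - prof ν x)))) := by
    refine .of_hasDerivAt (fun x => ?_) (by fun_prop)
    refine ((hasDerivAt_tanhTwo x).mul ((hasDerivAt_prof ν x).pow (k + 1))).congr_deriv ?_
    have := tanhTwo_sq x
    push_cast
    rw [Pi.pow_apply]
    rw [pow_succ (prof ν x) k]
    linear_combination (-2 * prof ν x ^ k * prof ν x - 2 * (k + 1) * prof ν x ^ k * prof ν x *
      (1 - prof ν x)) * this
  have i₁ : Integrable fun x => tanhTwo x * prof ν x ^ (k + 1) := by
    refine (integrable_prof_mul h0 (f := fun x => tanhTwo x * prof ν x ^ k) (by fun_prop) 1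
      fun x => ?_).congr (Eventually.of_forall fun x => by ring)
    have p0 := prof_pos ν x
    rw [abs_mul, abs_of_nonneg (by positivity : 0 ≤ prof ν x ^ k)]
    exact mul_le_one₀ (abs_tanhTwo_le_one x) (by positivity)
      (pow_le_one₀ p0.le (prof_le_one ν x))
  have i₂ := integrable_profMoment h0 k
  have bd : ∀ x, 0 ≤ 1 - (prof ν x ^ (k + 1)) ∧
      1 - (prof ν x ^ (k + 1)) ≤ (k + 1) * (1 - prof ν x) := fun x => by
    have p0 := prof_pos ν x
    have p1 := prof_le_one ν x
    refine ⟨sub_nonneg.2 (pow_le_one₀ p0.le p1), ?_⟩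
    have := one_add_mul_le_pow (a := prof ν x - 1) (by linarith) (k + 1)
    push_cast at this
    rw [add_sub_cancel] at this
    linarith
  have i₃ : Integrable fun x => sechTwo x ^ 2 * (prof ν x ^ (k + 1) +
        (k + 1) * (prof ν x ^ (k + 1) * (1 - prof ν x))) := by
    refine integrable_sechTwo_sq.mul_bdd (c := k + 2)
      (by fun_prop) (Eventually.of_forall fun x => ?_)
    have p0 := prof_pos ν x
    have p1 := prof_le_one ν x
    have p2 : 0 ≤ 1 - prof ν x := by linarith
    have q1 := pow_le_one₀ (n := k + 1) p0.le p1
    have q2 : prof ν x ^ (k + 1) * (1 - prof ν x) ≤ 1 := mul_le_one₀ q1 p2 (by linarith)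
    rw [Real.norm_of_nonneg (by positivity)]
    have : ((k : ℝ) + 1) * (prof ν x ^ (k + 1) * (1 - prof ν x)) ≤ (k + 1) * 1 := by gcongr
    linarith
  have h := hp.integral_eq_zero i₁ ((i₃.const_mul 2).sub ((i₂.const_mul _).const_mul 2))
  rw [integral_sub (i₃.const_mul 2) ((i₂.const_mul _).const_mul 2), integral_const_mul,
    integral_const_mul, integral_const_mul] at h
  change 2 * _ - 2 * ((k + 1) * profMoment ν (k + 1)) = 0 at h
  have e : (k + 1) * profMoment ν (k + 1) - 1 = ∫ x, (sechTwo x ^ 2 * (prof ν x ^ (k + 1) +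
        (k + 1) * (prof ν x ^ (k + 1) * (1 - prof ν x))) - sechTwo x ^ 2) := by
    rw [integral_sub i₃ integrable_sechTwo_sq, integral_sechTwo_sq]
    linarith
  rw [e, ← Real.norm_eq_abs]
  refine (norm_integral_le_of_norm_le
    (integrable_sechTwo.const_mul ((k + 1) * √ν)) (Eventually.of_forall fun x => ?_)).trans ?_
  · have p0 := prof_pos ν x
    have p1 := prof_le_one ν x
    have p2 : 0 ≤ 1 - prof ν x := by linarith
    have z0 := sechTwo_pos x
    have q1 := pow_le_one₀ (n := k + 1) p0.le p1
    have q0 : 0 ≤ prof ν x ^ (k + 1) := by positivity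
    obtain ⟨b1, b2⟩ := bd x
    have hr : sechTwo x ^ 2 * (1 - prof ν x) ≤ √ν * sechTwo x := by
      have e₁ : sechTwo x ^ 2 * (1 - prof ν x) = sechTwo x * (√ν * prof ν x) := by
        linear_combination sechTwo x * one_sub_prof_mul ν x
      rw [e₁]
      nlinarith [mul_nonneg z0.le hs]
    have e₂ : sechTwo x ^ 2 * (prof ν x ^ (k + 1) +
        (k + 1) * (prof ν x ^ (k + 1) * (1 - prof ν x))) - sechTwo x ^ 2 = sechTwo x ^ 2 *
        ((k + 1) * (prof ν x ^ (k + 1) * (1 - prof ν x)) - (1 - prof ν x ^ (k + 1))) := by ring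
    have h₁ : |(k + 1) * (prof ν x ^ (k + 1) * (1 - prof ν x)) - (1 - prof ν x ^ (k + 1))| ≤
        (k + 1) * (1 - prof ν x) := by
      have h₂ : prof ν x ^ (k + 1) * (1 - prof ν x) ≤ 1 - prof ν x :=
        mul_le_of_le_one_left p2 q1
      have h₃ : ((k : ℝ) + 1) * (prof ν x ^ (k + 1) * (1 - prof ν x)) ≤
        (k + 1) * (1 - prof ν x) := by gcongr
      have h₄ : 0 ≤ ((k : ℝ) + 1) * (prof ν x ^ (k + 1) * (1 - prof ν x)) := by positivity
      rw [abs_le]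
      constructor <;> linarith
    rw [e₂, Real.norm_eq_abs, abs_mul, abs_of_nonneg (sq_nonneg (sechTwo x))]
    calc _ ≤ sechTwo x ^ 2 * ((k + 1) * (1 - prof ν x)) := by gcongr
      _ = (k + 1) * (sechTwo x ^ 2 * (1 - prof ν x)) := by ring
      _ ≤ (k + 1) * (√ν * sechTwo x) := by gcongr
      _ = _ := by ring
  · rw [integral_const_mul]
    have := integral_sechTwo_le
    calc ((k : ℝ) + 1) * √ν * ∫ x, sechTwo x ≤ (k + 1) * √ν * 2 := by gcongr
      _ = _ := by ring

/-! ## Derivatives of the pulse and of `σ` -/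

theorem pulse_eq (ν x : ℝ) : pulse ν x = √(3 / 4 * (1 - ν) * prof ν x) := by
  rw [pulse, pulseSq, prof, mul_one_div]

theorem pulse_sq (h1 : ν < 1) (x : ℝ) : pulse ν x ^ 2 = 3 / 4 * (1 - ν) * prof ν x := by
  rw [pulse_eq, Real.sq_sqrt]
  have := prof_pos ν x
  have : 0 < 1 - ν := by linarith
  positivity

theorem pulse_pos (h1 : ν < 1) (x : ℝ) : 0 < pulse ν x := by
  rw [pulse_eq]
  have := prof_pos ν x
  have : 0 < 1 - ν := by linarith
  positivity

/-- The derivative of the pulse. -/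
def pulseDeriv (ν x : ℝ) : ℝ := pulse ν x * -(tanhTwo x * (1 - prof ν x))

/-- The second derivative of the pulse. -/
def pulseDeriv₂ (ν x : ℝ) : ℝ :=
  pulse ν x * (1 - 4 * prof ν x + 3 * (1 - ν) * prof ν x ^ 2)

theorem hasDerivAt_pulse (h1 : ν < 1) (x : ℝ) : HasDerivAt (pulse ν) (pulseDeriv ν x) x := by
  have hp := pulse_pos h1 x
  have hne : 3 / 4 * (1 - ν) * prof ν x ≠ 0 := by
    rw [← pulse_sq h1 x]
    positivity
  have e : pulse ν = fun y => √(3 / 4 * (1 - ν) * prof ν y) := funext (pulse_eq ν)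
  have h := ((hasDerivAt_prof ν x).const_mul (3 / 4 * (1 - ν))).sqrt hne
  rw [← e, ← pulse_eq] at h
  refine h.congr_deriv ?_
  rw [div_eq_iff (by positivity), pulseDeriv]
  linear_combination (-(2 * tanhTwo x * (1 - prof ν x))) * -pulse_sq h1 x

theorem hasDerivAt_pulseDeriv (h0 : 0 < ν) (h1 : ν < 1) (x : ℝ) :
    HasDerivAt (pulseDeriv ν) (pulseDeriv₂ ν x) x := by
  refine ((hasDerivAt_pulse h1 x).mul (((hasDerivAt_tanhTwo x).mul
    ((hasDerivAt_prof ν x).const_sub 1)).neg)).congr_deriv ?_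
  have h₁ := tanhTwo_sq x
  have h₂ := one_sub_prof_mul ν x
  have h₃ := Real.sq_sqrt h0.le
  simp only [pulseDeriv, pulseDeriv₂, Pi.mul_apply, Pi.neg_apply]
  generalize pulse ν x = r at *
  generalize prof ν x = u at *
  generalize tanhTwo x = t at *
  generalize sechTwo x = z at *
  generalize √ν = s at *
  subst h₃
  linear_combination (r * ((1 - u) ^ 2 + 2 * (1 - u) - 2 * u * (1 - u))) * h₁ +
    (-r * ((1 - u) * z + s * u) - 2 * r * z + 2 * r * u * z - 2 * r * s * u) * h₂

/-- This is the pulse equation differentiated in `x`, divided by `m`: the translation mode `r'` lies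
in the kernel of `A`. -/
theorem hasDerivAt_pulseDeriv₂ (h1 : ν < 1) (x : ℝ) :
    HasDerivAt (pulseDeriv₂ ν) (scaledPot ν x * pulseDeriv ν x) x := by
  have hu := hasDerivAt_prof ν x
  refine ((hasDerivAt_pulse h1 x).mul (((hu.const_mul 4).const_sub 1).add
    ((hu.pow 2).const_mul (3 * (1 - ν))))).congr_deriv ?_
  simp only [pulseDeriv, scaledPot, Pi.add_apply, Pi.pow_apply]
  push_cast
  ring

theorem continuous_pulseDeriv (ν : ℝ) : Continuous (pulseDeriv ν) := by
  have := continuous_pulse ν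
  have := continuous_tanhTwo
  have := continuous_prof ν
  unfold pulseDeriv
  fun_prop

theorem continuous_pulseDeriv₂ (ν : ℝ) : Continuous (pulseDeriv₂ ν) := by
  have := continuous_pulse ν
  have := continuous_prof ν
  unfold pulseDeriv₂
  fun_prop

/-- Since `(1 + ν)/(1 - ν) = 1 + 2ν/(1 - ν)`, this is `r (1 - u)` up to order `ν`. The factor `1 -
u` removes the plateau, so `‖σ‖` stays bounded while the length `L` grows. -/
theorem sigma_eq (h0 : 0 < ν) (h1 : ν < 1) (x : ℝ) :
    sigma ν x = pulse ν x * ((1 + ν) / (1 - ν) - prof ν x) := by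
  have hs := Real.sqrt_pos.2 h0
  have hL : 4 * Real.exp (-4 * shelf ν) = ν := by
    have h := sqrt_eq_exp_shelf h0
    have h₂ := Real.mul_self_sqrt h0.le
    rw [show -4 * shelf ν = -2 * shelf ν + -2 * shelf ν by ring, Real.exp_add]
    linear_combination h₂ - (√ν + 2 * Real.exp (-2 * shelf ν)) * h
  have hD := (zero_lt_one.trans_le (one_le_denom ν x))
  have hp := pulse_pos h1 x
  have hsq : pulseSq ν x ≠ 0 := by
    have : 0 < 1 - ν := by linarith
    unfold pulseSq
    positivity
  have hd : HasDerivAt (fun l : ℝ => 4 * Real.exp (-4 * l)) (-4 * ν) (shelf ν) := by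
    have := (((hasDerivAt_id (shelf ν)).const_mul (-4)).exp).const_mul 4
    refine this.congr_deriv ?_
    simp only [id]
    linear_combination -4 * hL
  have hn : HasDerivAt (fun n : ℝ => pulse n x) _ ν :=
    (((((hasDerivAt_id ν).const_sub 1).const_mul (3 / 4)).div
      ((((hasDerivAt_id ν).sqrt h0.ne').mul_const (Real.cosh (2 * x))).const_add 1)
      hD.ne').sqrt hsq)
  rw [← hL] at hn
  have hc := (hn.comp (shelf ν) hd).deriv
  rw [hL] at hc
  change sigma ν x = _ at hc
  rw [hc]
  have e : √(((fun n : ℝ => 3 / 4 * (1 - id n)) / fun n : ℝ => 1 + √(id n) * Real.cosh (2 * x)) ν)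
        = pulse ν x := rfl
  have hx := pulse_sq h1 x
  rw [e]
  unfold prof at *
  have h1' : 1 - ν ≠ 0 := by linarith
  have hD' := hD.ne'
  have hν := Real.sq_sqrt h0.le
  simp only [id]
  generalize Real.cosh (2 * x) = c at *
  generalize pulse ν x = r at *
  have hr := hp.ne'
  field_simp
  field_simp at hx
  generalize √ν = s at *
  subst hν
  linear_combination (-s * ((1 + s * c) * (1 + s ^ 2) - (1 - s ^ 2))) * hx

/-- The derivative of `σ`. -/
def sigmaDeriv (ν x : ℝ) : ℝ := pulseDeriv ν x * ((1 + ν) / (1 - ν) - 3 * prof ν x)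

/-- The second derivative of `σ`. -/
def sigmaDeriv₂ (ν x : ℝ) : ℝ := pulseDeriv₂ ν x * ((1 + ν) / (1 - ν) - 3 * prof ν x) -
  pulse ν x * (6 * prof ν x * ((1 - prof ν x) ^ 2 - ν * prof ν x ^ 2))

theorem hasDerivAt_sigma (h0 : 0 < ν) (h1 : ν < 1) (x : ℝ) :
    HasDerivAt (sigma ν) (sigmaDeriv ν x) x := by
  rw [show sigma ν = _ from funext (sigma_eq h0 h1)]
  refine ((hasDerivAt_pulse h1 x).mul ((hasDerivAt_prof ν x).const_sub _)).congr_deriv ?_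
  simp only [sigmaDeriv, pulseDeriv]
  ring

theorem hasDerivAt_sigmaDeriv (h0 : 0 < ν) (h1 : ν < 1) (x : ℝ) :
    HasDerivAt (sigmaDeriv ν) (sigmaDeriv₂ ν x) x := by
  refine ((hasDerivAt_pulseDeriv h0 h1 x).mul
    (((hasDerivAt_prof ν x).const_mul 3).const_sub _)).congr_deriv ?_
  have h₁ := tanhTwo_sq x
  have h₂ := one_sub_prof_mul ν x
  have h₃ := Real.sq_sqrt h0.le
  simp only [sigmaDeriv₂, pulseDeriv, pulseDeriv₂]
  generalize pulse ν x = r at *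
  generalize prof ν x = u at *
  generalize tanhTwo x = t at *
  generalize sechTwo x = z at *
  generalize √ν = s at *
  subst h₃
  linear_combination (-6 * r * u * (1 - u) ^ 2) * h₁ + (6 * r * u * ((1 - u) * z + s * u)) * h₂

theorem continuous_sigmaDeriv (ν : ℝ) : Continuous (sigmaDeriv ν) := by
  have := continuous_pulseDeriv ν
  have := continuous_prof ν
  unfold sigmaDeriv
  fun_prop

theorem continuous_sigmaDeriv₂ (ν : ℝ) : Continuous (sigmaDeriv₂ ν) := by
  have := continuous_pulseDeriv₂ ν
  have := continuous_pulse ν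
  have := continuous_prof ν
  unfold sigmaDeriv₂
  fun_prop

theorem potential_eq (h1 : ν < 1) (x : ℝ) : potential ν x = mass ν * scaledPot ν x := by
  have h := pulse_sq h1 x
  rw [potential, mass, scaledPot, show pulse ν x ^ 4 = (pulse ν x ^ 2) ^ 2 by ring, h]
  ring

theorem rho_eq (h1 : ν < 1) (x : ℝ) : rho ν x = pulse ν x * (3 * ν * prof ν x *
    (3 / 4 * (1 - ν) * prof ν x - 1)) := by
  have h := pulse_sq h1 x
  have h1' : 1 - ν ≠ 0 := by linarith
  rw [rho, show pulse ν x ^ 5 - pulse ν x ^ 3 =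
    pulse ν x * (pulse ν x ^ 2) * (pulse ν x ^ 2 - 1) by ring, h]
  field_simp

/-- Differentiating the pulse equation in `L` gives `A σ = -(dm/dL) (r - r'')`, where `dm/dL = 3ν/4`
and `m (r - r'') = r³ - r⁵`. With the explicit formulas the identity is algebraic. -/
theorem opA_sigma_eq_rho (h1 : ν < 1) (h0 : 0 < ν) (x : ℝ) :
    -mass ν * sigmaDeriv₂ ν x + potential ν x * sigma ν x = rho ν x := by
  have h1' : 1 - ν ≠ 0 := by linarith
  rw [rho_eq h1, potential_eq h1, sigma_eq h0 h1, sigmaDeriv₂, pulseDeriv₂, scaledPot, mass]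
  field_simp
  ring

/-! ## Square integrability -/

theorem memLp_pulse (h0 : 0 < ν) (h1 : ν < 1) : MemLp (pulse ν) 2 (volume : Measure ℝ) := by
  rw [memLp_two_iff_integrable_sq (continuous_pulse ν).aestronglyMeasurable]
  simp_rw [pulse_sq h1]
  exact (integrable_prof h0).const_mul _

theorem memLp_pulse_mul (h0 : 0 < ν) (h1 : ν < 1) {f : ℝ → ℝ} (hf : Continuous f) (c : ℝ)
    (hc : ∀ x, |f x| ≤ c) : MemLp (fun x => pulse ν x * f x) 2 (volume : Measure ℝ) :=
  (memLp_top_of_bound hf.aestronglyMeasurable c (Eventually.of_forall hc)).mul'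
    (memLp_pulse h0 h1)

/-- Every function in play is `r` times a continuous function of `(tanh 2x, u)`, which ranges in a
compact rectangle. -/
theorem memLp_pulse_mul_comp (h0 : 0 < ν) (h1 : ν < 1) {f : ℝ → ℝ → ℝ}
    (hf : Continuous fun p : ℝ × ℝ => f p.1 p.2) :
    MemLp (fun x => pulse ν x * f (tanhTwo x) (prof ν x)) 2 (volume : Measure ℝ) := by
  have ct := continuous_tanhTwo
  have cu := continuous_prof ν
  obtain ⟨c, hc⟩ := ((isCompact_Icc (a := (-1 : ℝ)) (b := 1)).prod
    (isCompact_Icc (a := (0 : ℝ)) (b := 1))).exists_bound_of_continuousOn hf.continuousOn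
  exact memLp_pulse_mul h0 h1 (hf.comp (ct.prodMk cu)) c fun x =>
    hc (tanhTwo x, prof ν x) ⟨abs_le.1 (abs_tanhTwo_le_one x), (prof_pos ν x).le, prof_le_one ν x⟩

theorem memLp_pulseDeriv (h0 : 0 < ν) (h1 : ν < 1) :
    MemLp (pulseDeriv ν) 2 (volume : Measure ℝ) :=
  memLp_pulse_mul_comp h0 h1 (f := fun t u => -(t * (1 - u))) (by fun_prop)

theorem memLp_pulseDeriv₂ (h0 : 0 < ν) (h1 : ν < 1) :
    MemLp (pulseDeriv₂ ν) 2 (volume : Measure ℝ) :=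
  memLp_pulse_mul_comp h0 h1 (f := fun _ u => 1 - 4 * u + 3 * (1 - ν) * u ^ 2) (by fun_prop)

theorem memLp_pulseDeriv₃ (h0 : 0 < ν) (h1 : ν < 1) :
    MemLp (fun x => scaledPot ν x * pulseDeriv ν x) 2 (volume : Measure ℝ) := by
  refine (memLp_congr_ae (Eventually.of_forall fun x => ?_)).1 (memLp_pulse_mul_comp h0 h1
    (f := fun t u => -(t * (1 - u)) * (1 - 12 * u + 15 * (1 - ν) * u ^ 2)) (by fun_prop))
  simp only [pulseDeriv, scaledPot]
  ring

theorem memLp_sigma (h0 : 0 < ν) (h1 : ν < 1) : MemLp (sigma ν) 2 (volume : Measure ℝ) := by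
  rw [show sigma ν = _ from funext (sigma_eq h0 h1)]
  exact memLp_pulse_mul_comp h0 h1 (f := fun _ u => (1 + ν) / (1 - ν) - u) (by fun_prop)

theorem memLp_sigmaDeriv (h0 : 0 < ν) (h1 : ν < 1) :
    MemLp (sigmaDeriv ν) 2 (volume : Measure ℝ) := by
  refine (memLp_congr_ae (Eventually.of_forall fun x => ?_)).1 (memLp_pulse_mul_comp h0 h1
    (f := fun t u => -(t * (1 - u)) * ((1 + ν) / (1 - ν) - 3 * u)) (by fun_prop))
  simp only [sigmaDeriv, pulseDeriv]
  ring

theorem memLp_sigmaDeriv₂ (h0 : 0 < ν) (h1 : ν < 1) :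
    MemLp (sigmaDeriv₂ ν) 2 (volume : Measure ℝ) := by
  refine (memLp_congr_ae (Eventually.of_forall fun x => ?_)).1 (memLp_pulse_mul_comp h0 h1
    (f := fun _ u => (1 - 4 * u + 3 * (1 - ν) * u ^ 2) * ((1 + ν) / (1 - ν) - 3 * u) -
      6 * u * ((1 - u) ^ 2 - ν * u ^ 2)) (by fun_prop))
  simp only [sigmaDeriv₂, pulseDeriv₂]
  ring

theorem memLp_rho (h0 : 0 < ν) (h1 : ν < 1) : MemLp (rho ν) 2 (volume : Measure ℝ) := by
  rw [show rho ν = _ from funext (rho_eq h1)]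
  exact memLp_pulse_mul_comp h0 h1
    (f := fun _ u => 3 * ν * u * (3 / 4 * (1 - ν) * u - 1)) (by fun_prop)

theorem hasWeakDeriv_toLp {f f' : ℝ → ℝ} (hf : MemLp f 2 (volume : Measure ℝ))
    (hf' : MemLp f' 2 (volume : Measure ℝ)) (hd : ∀ x, HasDerivAt f (f' x) x)
    (hc : Continuous f') : HasWeakDeriv (hf.toLp f) (hf'.toLp f') :=
  ((IsPrimitive.of_hasDerivAt hd hc).congr_ae hf'.coeFn_toLp.symm).hasWeakDeriv
    hf.coeFn_toLp.symm

/-! ## Norms and inner products -/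

theorem nu_mul_integral_prof_le (h0 : 0 < ν) (h1 : ν ≤ 1) :
    ν * ∫ x, prof ν x ≤ 3 * √ν := by
  have hs := Real.sqrt_pos.2 h0
  have hs1 := Real.sqrt_le_one.2 h1
  have hν := Real.sq_sqrt h0.le
  have hJ := integral_prof_le h0 h1
  have hL := shelf_le h0
  rw [le_div_iff₀ hs] at hL
  have h₁ : √ν * ∫ x, prof ν x ≤ 3 := by
    have := mul_le_mul_of_nonneg_left hJ hs.le
    linarith
  have h₂ := mul_le_mul_of_nonneg_left h₁ hs.le
  calc ν * ∫ x, prof ν x = √ν * (√ν * ∫ x, prof ν x) := by rw [← mul_assoc, ← sq, hν]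
    _ ≤ _ := by linarith

/-- With `δ = 2ν/(1 - ν)`, `σ² = 3/4 (1 - ν) u (1 - u + δ)²`. Since `u (1 - u)² = u (1 - u) - u² (1
- u)`, the leading term is `3/4 (1 - 1/2)`. -/
theorem integral_sigma_sq (h0 : 0 < ν) (h1 : √ν ≤ 1 / 1000) :
    |(∫ x, sigma ν x * sigma ν x) - 3 / 8| ≤ 100 * √ν := by
  have hs := Real.sqrt_pos.2 h0
  have hν := Real.sq_sqrt h0.le
  have hν1 : ν ≤ 1 / 1000000 := by nlinarith
  have i₁ := integrable_profMoment h0 0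
  have i₂ := integrable_profMoment h0 1
  have i₀ := integrable_prof h0
  have m₁ := abs_profMoment_sub_le h0 0
  have m₂ := abs_profMoment_sub_le h0 1
  simp only [zero_add, Nat.reduceAdd, CharP.cast_eq_zero, Nat.cast_one, one_mul] at i₁ i₂ m₁ m₂
  set δ : ℝ := 2 * ν / (1 - ν) with hδ
  have hδ0 : 0 ≤ δ := div_nonneg (by linarith) (by linarith)
  have hδ1 : δ ≤ 3 * ν := by
    rw [hδ, div_le_iff₀ (by linarith)]
    nlinarith
  have e : ∀ x, sigma ν x * sigma ν x = 3 / 4 * (1 - ν) * ((1 + 2 * δ) *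
      (prof ν x ^ 1 * (1 - prof ν x)) - prof ν x ^ 2 * (1 - prof ν x) + δ ^ 2 * prof ν x) := by
    intro x
    have h := pulse_sq (by linarith : ν < 1) x
    rw [sigma_eq h0 (by linarith), show (1 + ν) / (1 - ν) = 1 + δ by
      rw [hδ]
      field_simp [(by linarith : 1 - ν ≠ 0)]
      ring]
    linear_combination (1 + δ - prof ν x) ^ 2 * h
  have e' : ∫ x, sigma ν x * sigma ν x = 3 / 4 * (1 - ν) * ((1 + 2 * δ) * profMoment ν 1 -
      profMoment ν 2 + δ ^ 2 * ∫ x, prof ν x) := by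
    have j₁ := i₁.const_mul (1 + 2 * δ)
    have j₂ : Integrable fun x => (1 + 2 * δ) * (prof ν x ^ 1 * (1 - prof ν x)) -
      prof ν x ^ 2 * (1 - prof ν x) := j₁.sub i₂
    simp_rw [e]
    rw [integral_const_mul, integral_add j₂ (i₀.const_mul _),
      integral_sub j₁ i₂, integral_const_mul, integral_const_mul]
    rfl
  rw [e']
  have hJ := nu_mul_integral_prof_le h0 (by linarith)
  have hJ0 := integral_prof_nonneg (ν := ν)
  generalize (∫ x, prof ν x) = J at *
  generalize profMoment ν 1 = I₁ at *
  generalize profMoment ν 2 = I₂ at *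
  have hJ' : δ * J ≤ 9 * √ν := by nlinarith
  have hJ'' : δ ^ 2 * J ≤ 9 * √ν := by nlinarith
  have hJ0' : 0 ≤ δ ^ 2 * J := by positivity
  have hνs : ν ≤ √ν / 1000 := by nlinarith
  rw [abs_le] at m₁ m₂
  have hδI : |2 * δ * I₁| ≤ 12 * √ν / 1000 := by
    rw [abs_le]
    constructor <;> nlinarith
  rw [abs_le] at hδI
  obtain ⟨X, hX⟩ : ∃ X, X = (1 + 2 * δ) * I₁ - I₂ + δ ^ 2 * J := ⟨_, rfl⟩
  have hX1 : X ≤ 1 / 2 + 20 * √ν := by linarith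
  have hX0 : 1 / 2 - 20 * √ν ≤ X := by linarith
  rw [← hX, abs_le]
  constructor <;> nlinarith

/-- To leading order the integrand is `9ν/4 (3/4 u³ - u²) (1 - u)`, and the moments `1/3` and `1/2`
give `9ν/4 (1/4 - 1/2)`. -/
theorem integral_sigma_mul_rho (h0 : 0 < ν) (h1 : √ν ≤ 1 / 1000) :
    |(∫ x, sigma ν x * rho ν x) + 9 / 16 * ν| ≤ 100 * (ν * √ν) := by
  have hs := Real.sqrt_pos.2 h0
  have hν := Real.sq_sqrt h0.le
  have hν1 : ν ≤ 1 / 1000000 := by nlinarith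
  have i₂ := integrable_profMoment h0 1
  have i₃ := integrable_profMoment h0 2
  have m₂ := abs_profMoment_sub_le h0 1
  have m₃ := abs_profMoment_sub_le h0 2
  have cu := continuous_prof ν
  simp only [Nat.reduceAdd, Nat.cast_one, Nat.cast_ofNat] at i₂ i₃ m₂ m₃
  set δ : ℝ := 2 * ν / (1 - ν) with hδ
  set b : ℝ := 3 / 4 * (1 - ν) with hb
  have hδ0 : 0 ≤ δ := div_nonneg (by linarith) (by linarith)
  have hδ1 : δ ≤ 3 * ν := by
    rw [hδ, div_le_iff₀ (by linarith)]
    nlinarith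
  have hbd : ∀ x, |b * prof ν x ^ 2 - prof ν x| ≤ 1 := fun x => by
    have p0 := prof_pos ν x
    have p1 := prof_le_one ν x
    rw [abs_le]
    constructor <;> nlinarith
  have i₀ : Integrable fun x => prof ν x * (b * prof ν x ^ 2 - prof ν x) :=
    integrable_prof_mul h0 (by fun_prop) 1 hbd
  have e : ∀ x, sigma ν x * rho ν x = 3 * ν * b * (b * (prof ν x ^ 3 * (1 - prof ν x)) -
      prof ν x ^ 2 * (1 - prof ν x) + δ * (prof ν x * (b * prof ν x ^ 2 - prof ν x))) := by
    intro x
    have h := pulse_sq (by linarith : ν < 1) x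
    rw [sigma_eq h0 (by linarith), rho_eq (by linarith), show (1 + ν) / (1 - ν) = 1 + δ by
      rw [hδ]
      field_simp [(by linarith : 1 - ν ≠ 0)]
      ring, ← hb]
    rw [← hb] at h
    linear_combination (1 + δ - prof ν x) * (3 * ν * prof ν x * (b * prof ν x - 1)) * h
  have e' : ∫ x, sigma ν x * rho ν x = 3 * ν * b * (b * profMoment ν 3 -
      profMoment ν 2 + δ * ∫ x, prof ν x * (b * prof ν x ^ 2 - prof ν x)) := by
    have j₁ := i₃.const_mul b
    have j₂ : Integrable fun x => b * (prof ν x ^ 3 * (1 - prof ν x)) -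
      prof ν x ^ 2 * (1 - prof ν x) := j₁.sub i₂
    simp_rw [e]
    rw [integral_const_mul, integral_add j₂ (i₀.const_mul _),
      integral_sub j₁ i₂, integral_const_mul, integral_const_mul]
    rfl
  have hK : |∫ x, prof ν x * (b * prof ν x ^ 2 - prof ν x)| ≤ ∫ x, prof ν x := by
    rw [← Real.norm_eq_abs]
    refine norm_integral_le_of_norm_le (integrable_prof h0) (Eventually.of_forall fun x => ?_)
    rw [Real.norm_eq_abs, abs_mul, abs_of_pos (prof_pos ν x)]
    exact mul_le_of_le_one_right (prof_pos ν x).le (hbd x)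
  rw [e']
  have hJ := nu_mul_integral_prof_le h0 (by linarith)
  have hJ0 := integral_prof_nonneg (ν := ν)
  generalize (∫ x, prof ν x * (b * prof ν x ^ 2 - prof ν x)) = K at *
  generalize (∫ x, prof ν x) = J at *
  generalize profMoment ν 3 = I₃ at *
  generalize profMoment ν 2 = I₂ at *
  have hJ' : δ * J ≤ 9 * √ν := by nlinarith
  rw [abs_le] at m₂ m₃ hK
  have hK1 : δ * K ≤ 9 * √ν := (mul_le_mul_of_nonneg_left hK.2 hδ0).trans hJ'
  have hK0 : -(9 * √ν) ≤ δ * K := by nlinarith [mul_le_mul_of_nonneg_left hK.1 hδ0]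
  have hνs : ν ≤ √ν / 1000 := by nlinarith
  have hb1 : |(b - 3 / 4) * I₃| ≤ √ν / 1000 := by
    rw [hb, abs_le]
    constructor <;> nlinarith
  rw [abs_le] at hb1
  obtain ⟨X, hX⟩ : ∃ X, X = b * I₃ - I₂ + δ * K := ⟨_, rfl⟩
  have hX1 : X ≤ -1 / 4 + 20 * √ν := by linarith
  have hX0 : -1 / 4 - 20 * √ν ≤ X := by linarith
  have hY : |3 * b * X + 9 / 16| ≤ 100 * √ν := by
    rw [hb, abs_le]
    constructor <;> nlinarith
  rw [← hX, show 3 * ν * b * X + 9 / 16 * ν = ν * (3 * b * X + 9 / 16) by ring, abs_mul,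
    abs_of_pos h0]
  nlinarith

/-- Unlike `σ`, the function `ρ` does not vanish on the plateau. Its bound `ρ² ≤ 9 ν² u` is the
source of the factor `√L` in the theorem. -/
theorem integral_rho_sq_le (h0 : 0 < ν) (h1 : ν ≤ 1 / 2) :
    ∫ x, rho ν x * rho ν x ≤ 100 * (ν ^ 2 * shelf ν) := by
  have hL := shelf_ge h0 (by linarith)
  have hJ := integral_prof_le h0 (by linarith)
  calc ∫ x, rho ν x * rho ν x ≤ ∫ x, 9 * ν ^ 2 * prof ν x := by
        have i := ((memLp_rho h0 (by linarith)).integrable_mul (memLp_rho h0 (by linarith)))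
        refine integral_mono i ((integrable_prof h0).const_mul _) fun x => ?_
        have h := pulse_sq (by linarith : ν < 1) x
        have p0 := prof_pos ν x
        have p1 := prof_le_one ν x
        simp only [rho_eq (by linarith : ν < 1)]
        have hq : |prof ν x * (3 / 4 * (1 - ν) * prof ν x - 1)| ≤ 1 := by
          rw [abs_le]
          constructor <;> nlinarith
        rw [← sq_le_one_iff_abs_le_one] at hq
        calc _ = 9 * ν ^ 2 * (3 / 4 * (1 - ν) * prof ν x) *
              (prof ν x * (3 / 4 * (1 - ν) * prof ν x - 1)) ^ 2 := by rw [← h]; ring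
          _ ≤ 9 * ν ^ 2 * (1 * prof ν x) * 1 := by
            gcongr
            linarith
          _ = _ := by ring
    _ = 9 * ν ^ 2 * ∫ x, prof ν x := integral_const_mul _ _
    _ ≤ 9 * ν ^ 2 * (5 * shelf ν) := by gcongr; linarith
    _ ≤ _ := by nlinarith [mul_nonneg (sq_nonneg ν) (by linarith : 0 ≤ shelf ν)]

/-! ## Eigenvalues of an operator given by a symmetric form -/

section Form

variable {V H : Type*} [NormedAddCommGroup V] [InnerProductSpace ℝ V]
  [NormedAddCommGroup H] [InnerProductSpace ℝ H]

/-- The inner product of a real Hilbert space as a bounded bilinear form. -/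
def innerBilin (H : Type*) [NormedAddCommGroup H] [InnerProductSpace ℝ H] : H →L[ℝ] H →L[ℝ] ℝ :=
  (innerₗ H).mkContinuous₂ 1 fun x y => by
    rw [one_mul]
    exact norm_inner_le_norm x y

/-- `v` is a weak solution of `T v = f`, where `T` is the operator in `H` associated with the
form `B` on `V`. -/
def IsWeakSolution (j : V →L[ℝ] H) (B : V →L[ℝ] V →L[ℝ] ℝ) (v : V) (f : H) : Prop :=
  ∀ w, B v w = inner ℝ f (j w)

/-- The form `B` is bounded below by `κ` on the vectors orthogonal to `p` and `q`. -/
def FormGap (j : V →L[ℝ] H) (B : V →L[ℝ] V →L[ℝ] ℝ) (p q : H) (κ : ℝ) : Prop :=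
  ∀ v, inner ℝ p (j v) = 0 → inner ℝ q (j v) = 0 → κ * ‖j v‖ ^ 2 ≤ B v v

variable {j : V →L[ℝ] H} {B : V →L[ℝ] V →L[ℝ] ℝ}

theorem IsWeakSolution.sub {v w : V} {f g : H} (hv : IsWeakSolution j B v f)
    (hw : IsWeakSolution j B w g) : IsWeakSolution j B (v - w) (f - g) := fun z => by
  rw [map_sub, sub_apply, hv, hw, inner_sub_left]

theorem coercive_of_gap {N : Set V} {δ C κ μ : ℝ} (hδ : 0 < δ)
    (hG : ∀ v, δ * ‖v‖ ^ 2 ≤ B v v + C * ‖j v‖ ^ 2)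
    (hgap : ∀ v ∈ N, κ * ‖j v‖ ^ 2 ≤ B v v) (hμ : μ < κ) :
    ∃ c, 0 < c ∧ ∀ v ∈ N, c * ‖v‖ ^ 2 ≤ B v v - μ * ‖j v‖ ^ 2 := by
  -- The Gårding inequality with weight `θ` is averaged with the gap with weight `1 - θ`. Enlarging
  -- `C` to `D` ensures `κ + D ≥ 1`, so that `θ` is well defined and positive.
  set D := max C (1 - κ)
  have hD₁ : C ≤ D := le_max_left _ _
  have hD₂ : 1 - κ ≤ D := le_max_right _ _
  set θ := min 1 ((κ - μ) / (κ + D))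
  have hθ₁ : θ ≤ 1 := min_le_left _ _
  have hθ₂ : θ * (κ + D) ≤ κ - μ := by
    rw [← le_div_iff₀ (by linarith)]
    exact min_le_right _ _
  have hθ : 0 < θ := lt_min one_pos (div_pos (by linarith) (by linarith))
  refine ⟨θ * δ, by positivity, fun v hv => ?_⟩
  have h₁ := mul_le_mul_of_nonneg_left (hG v) hθ.le
  have h₂ := mul_le_mul_of_nonneg_left (hgap v hv) (sub_nonneg.2 hθ₁)
  have h₃ := mul_le_mul_of_nonneg_right hθ₂ (sq_nonneg ‖j v‖)
  have h₄ := mul_le_mul_of_nonneg_right hD₁ (mul_nonneg hθ.le (sq_nonneg ‖j v‖))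
  linarith

/-- A vector orthogonal to `p` and `e` becomes orthogonal to `σ` after subtraction of a multiple `θ
e`. This adds `θ² l ‖e‖² ≤ 0` to the energy and does not decrease the norm. -/
theorem formGap_of_groundState (hsymm : ∀ v w, B v w = B w v) {κ l : ℝ} (hκ : 0 ≤ κ)
    (hl : l ≤ 0) {p σ e : V}
    (hgap : FormGap j B (j p) (j σ) κ) (hσ : j σ ≠ 0) (hpe : inner ℝ (j p) (j e) = 0)
    (hσe : inner ℝ (j σ) (j e) = ‖j σ‖ ^ 2) (he : IsWeakSolution j B e (l • j e)) :
    FormGap j B (j p) (j e) κ := by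
  intro v hp hv
  set θ := inner ℝ (j σ) (j v) / ‖j σ‖ ^ 2 with hθ
  have hN : ‖j σ‖ ^ 2 ≠ 0 := pow_ne_zero 2 (norm_ne_zero_iff.2 hσ)
  have h := hgap (v - θ • e) (by
    rw [map_sub, map_smul, inner_sub_right, inner_smul_right, hp, hpe]; simp) (by
    rw [map_sub, map_smul, inner_sub_right, inner_smul_right, hσe, hθ, div_mul_cancel₀ _ hN,
      sub_self])
  have hev : B e v = 0 := by rw [he, inner_smul_left, hv, mul_zero]
  have hee : B e e = l * ‖j e‖ ^ 2 := by
    rw [he, inner_smul_left, real_inner_self_eq_norm_sq]; simp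
  have hn : ‖j v - θ • j e‖ ^ 2 = ‖j v‖ ^ 2 + θ ^ 2 * ‖j e‖ ^ 2 := by
    rw [norm_sub_sq_real, inner_smul_right, real_inner_comm, hv, norm_smul, mul_pow,
      Real.norm_eq_abs, sq_abs]
    ring
  simp only [map_sub, map_smul, sub_apply, smul_apply,
    smul_eq_mul, hsymm v e, hev, hee, hn] at h
  have h₁ : 0 ≤ κ * (θ ^ 2 * ‖j e‖ ^ 2) := by positivity
  have h₂ : l * (θ ^ 2 * ‖j e‖ ^ 2) ≤ 0 := mul_nonpos_of_nonpos_of_nonneg hl (by positivity)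
  linarith

theorem form_ge_of_formGap (hsymm : ∀ v w, B v w = B w v) {κ l : ℝ} (hl : l ≤ 0) (hκ : 0 ≤ κ)
    {p e : V} (hgap : FormGap j B (j p) (j e) κ) (hpe : inner ℝ (j p) (j e) = 0)
    (hp : IsWeakSolution j B p 0) (he : IsWeakSolution j B e (l • j e)) (hp0 : j p ≠ 0)
    (he0 : j e ≠ 0) (v : V) : l * ‖j v‖ ^ 2 ≤ B v v := by
  set a := inner ℝ (j p) (j v) / ‖j p‖ ^ 2 with ha
  set b := inner ℝ (j e) (j v) / ‖j e‖ ^ 2 with hb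
  have hNp : ‖j p‖ ^ 2 ≠ 0 := pow_ne_zero 2 (norm_ne_zero_iff.2 hp0)
  have hNe : ‖j e‖ ^ 2 ≠ 0 := pow_ne_zero 2 (norm_ne_zero_iff.2 he0)
  have hep : inner ℝ (j e) (j p) = 0 := by rw [real_inner_comm, hpe]
  have hpv : inner ℝ (j p) (j v) = a * ‖j p‖ ^ 2 := by rw [ha, div_mul_cancel₀ _ hNp]
  have hev : inner ℝ (j e) (j v) = b * ‖j e‖ ^ 2 := by rw [hb, div_mul_cancel₀ _ hNe]
  have hvp : inner ℝ (j v) (j p) = a * ‖j p‖ ^ 2 := by rw [real_inner_comm, hpv]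
  have hve : inner ℝ (j v) (j e) = b * ‖j e‖ ^ 2 := by rw [real_inner_comm, hev]
  have h := hgap (v - a • p - b • e) (by
    simp only [map_sub, map_smul, inner_sub_right, inner_smul_right, hpv, hpe,
      real_inner_self_eq_norm_sq]
    ring) (by
    simp only [map_sub, map_smul, inner_sub_right, inner_smul_right, hev, hep,
      real_inner_self_eq_norm_sq]
    ring)
  have hBp : ∀ w, B p w = 0 := fun w => by rw [hp, inner_zero_left]
  have hBev : B e v = l * (b * ‖j e‖ ^ 2) := by rw [he, inner_smul_left, hev]; simp
  have hBee : B e e = l * ‖j e‖ ^ 2 := by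
    rw [he, inner_smul_left, real_inner_self_eq_norm_sq]; simp
  have hn : ‖j v - a • j p - b • j e‖ ^ 2 =
      ‖j v‖ ^ 2 - a ^ 2 * ‖j p‖ ^ 2 - b ^ 2 * ‖j e‖ ^ 2 := by
    rw [← real_inner_self_eq_norm_sq]
    simp only [inner_sub_left, inner_sub_right, inner_smul_left, inner_smul_right,
      hpv, hev, hvp, hve, hpe, hep, real_inner_self_eq_norm_sq, conj_trivial]
    ring
  have hn0 : 0 ≤ ‖j v - a • j p - b • j e‖ ^ 2 := by positivity
  simp only [map_sub, map_smul, sub_apply, smul_apply,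
    smul_eq_mul, hsymm v p, hsymm v e, hsymm e p, hBp, hBev, hBee] at h
  rw [hn] at h hn0
  have h₁ : 0 ≤ (κ - l) * (‖j v‖ ^ 2 - a ^ 2 * ‖j p‖ ^ 2 - b ^ 2 * ‖j e‖ ^ 2) :=
    mul_nonneg (by linarith) hn0
  have h₂ : l * (a ^ 2 * ‖j p‖ ^ 2) ≤ 0 := mul_nonpos_of_nonpos_of_nonneg hl (by positivity)
  linarith

variable [CompleteSpace V] [CompleteSpace H]

/-- Lax–Milgram on the orthogonal complement of `p` and `q`, where the shifted form is coercive. The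
numbers `α` and `β` are the Lagrange multipliers of the two constraints. -/
theorem exists_inner_eq_zero_of_formGap {δ C κ μ : ℝ} (hδ : 0 < δ)
    (hG : ∀ v, δ * ‖v‖ ^ 2 ≤ B v v + C * ‖j v‖ ^ 2) {p q : V} (hpq : inner ℝ (j p) (j q) = 0)
    (hgap : FormGap j B (j p) (j q) κ) (hμ : μ < κ) (f : H) :
    ∃ (v : V) (α β : ℝ), inner ℝ (j p) (j v) = 0 ∧ inner ℝ (j q) (j v) = 0 ∧
      IsWeakSolution j B v (f + μ • j v + α • j p + β • j q) := by
  let N : Submodule ℝ V :=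
    (innerSL ℝ (j p) ∘L j).ker ⊓ (innerSL ℝ (j q) ∘L j).ker
  have hN : ∀ v, v ∈ N ↔ inner ℝ (j p) (j v) = 0 ∧ inner ℝ (j q) (j v) = 0 := fun v => by
    simp [N]
  have hNc : IsClosed (N : Set V) :=
    (ContinuousLinearMap.isClosed_ker _).inter (ContinuousLinearMap.isClosed_ker _)
  have : CompleteSpace N := hNc.completeSpace_coe
  obtain ⟨c, hc, hcoer⟩ := coercive_of_gap (N := (N : Set V)) hδ hG
    (fun v hv => hgap v ((hN v).1 hv).1 ((hN v).1 hv).2) hμ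
  let jN : N →L[ℝ] H := j ∘L N.subtypeL
  let BN : N →L[ℝ] N →L[ℝ] ℝ := B.bilinearComp N.subtypeL N.subtypeL -
    μ • (innerBilin H).bilinearComp jN jN
  have hBN : ∀ v w : N, BN v w = B v w - μ * inner ℝ (j v) (j w) := fun v w => rfl
  have hco : IsCoercive BN := ⟨c, hc, fun v => by
    rw [hBN, real_inner_self_eq_norm_sq]
    have := hcoer v v.2
    rw [sq] at this
    rw [mul_assoc]
    exact this⟩
  let v : N := hco.continuousLinearEquivOfBilin.symm (ContinuousLinearMap.adjoint jN f)
  have hv : ∀ w ∈ N, B v w - μ * inner ℝ (j v) (j w) = inner ℝ f (j w) := fun w hw => by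
    have h := hco.continuousLinearEquivOfBilin_apply v ⟨w, hw⟩
    rw [hBN, ContinuousLinearEquiv.apply_symm_apply, ContinuousLinearMap.adjoint_inner_left] at h
    exact h.symm
  obtain ⟨hvp, hvq⟩ := (hN v).1 v.2
  refine ⟨v, (B v p - inner ℝ f (j p)) / ‖j p‖ ^ 2, (B v q - inner ℝ f (j q)) / ‖j q‖ ^ 2,
    hvp, hvq, fun w => ?_⟩
  -- The convention for division by zero makes this hold also for `r = 0`. Taking `p = q = 0`
  -- therefore gives the unconstrained case.
  have hcancel : ∀ r : H, ∀ x : V, inner ℝ r (j x) / ‖r‖ ^ 2 * ‖r‖ ^ 2 = inner ℝ r (j x) := by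
    intro r x
    by_cases h : r = 0
    · simp [h]
    · exact div_mul_cancel₀ _ (pow_ne_zero 2 (norm_ne_zero_iff.2 h))
  have hqp : inner ℝ (j q) (j p) = 0 := by rw [real_inner_comm, hpq]
  set a := inner ℝ (j p) (j w) / ‖j p‖ ^ 2 with ha
  set b := inner ℝ (j q) (j w) / ‖j q‖ ^ 2 with hb
  have hw := hv (w - a • p - b • q) ((hN _).2 ⟨by
    rw [map_sub, map_sub, map_smul, map_smul, inner_sub_right, inner_sub_right,
      inner_smul_right, inner_smul_right, hpq, real_inner_self_eq_norm_sq, hcancel]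
    ring, by
    rw [map_sub, map_sub, map_smul, map_smul, inner_sub_right, inner_sub_right,
      inner_smul_right, inner_smul_right, hqp, real_inner_self_eq_norm_sq, hcancel]
    ring⟩)
  rw [real_inner_comm] at hvp hvq
  simp only [map_sub, map_smul, inner_sub_right, inner_smul_right, smul_eq_mul, hvp, hvq] at hw
  simp only [inner_add_left, inner_smul_left, conj_trivial]
  rw [div_mul_eq_mul_div, mul_div_assoc, ← ha, div_mul_eq_mul_div, mul_div_assoc, ← hb]
  linarith

/-- Schur complement. For `μ ≤ 0` let `x(μ)` solve `(T - μ) x = ρ` on the complement of `p` and `σ`,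
up to a multiple of `σ`. Then `σ - x(μ)` is an eigenvector for `μ` exactly when the scalar `F(μ) =
⟨ρ, x(μ)⟩ / ‖σ‖² - a + μ` vanishes, and the intermediate value theorem supplies a zero. -/
theorem exists_groundState (hsymm : ∀ v w, B v w = B w v) {δ C κ a : ℝ} (hδ : 0 < δ)
    (hG : ∀ v, δ * ‖v‖ ^ 2 ≤ B v v + C * ‖j v‖ ^ 2) {p σ : V} {ρ : H}
    (hpσ : inner ℝ (j p) (j σ) = 0) (hp : IsWeakSolution j B p 0) (hp0 : j p ≠ 0)
    (hσ : IsWeakSolution j B σ ρ) (hσ0 : j σ ≠ 0) (hκ : 0 < κ)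
    (hgap : FormGap j B (j p) (j σ) κ) (ha : a < 0) (haσ : inner ℝ ρ (j σ) = a * ‖j σ‖ ^ 2) :
    ∃ (l : ℝ) (e : V), l ≤ a ∧ a - ‖ρ‖ ^ 2 / (κ * ‖j σ‖ ^ 2) ≤ l ∧
      inner ℝ (j p) (j e) = 0 ∧ inner ℝ (j σ) (j e) = ‖j σ‖ ^ 2 ∧
      IsWeakSolution j B e (l • j e) := by
  have hN : 0 < ‖j σ‖ ^ 2 := pow_pos (norm_pos_iff.2 hσ0) 2
  have hNp : 0 < ‖j p‖ ^ 2 := pow_pos (norm_pos_iff.2 hp0) 2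
  have key : ∀ μ : ℝ, ∃ x : V, μ ≤ 0 → inner ℝ (j p) (j x) = 0 ∧ inner ℝ (j σ) (j x) = 0 ∧
      IsWeakSolution j B x (ρ + μ • j x + (inner ℝ ρ (j x) / ‖j σ‖ ^ 2 - a) • j σ) := by
    intro μ
    by_cases hμ : μ ≤ 0
    · obtain ⟨x, α, β, h₁, h₂, h₃⟩ :=
        exists_inner_eq_zero_of_formGap hδ hG hpσ hgap (hμ.trans_lt hκ) ρ
      refine ⟨x, fun _ => ⟨h₁, h₂, ?_⟩⟩
      have h₁' : inner ℝ (j x) (j p) = 0 := by rw [real_inner_comm, h₁]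
      have h₂' : inner ℝ (j x) (j σ) = 0 := by rw [real_inner_comm, h₂]
      have hσp : inner ℝ (j σ) (j p) = 0 := by rw [real_inner_comm, hpσ]
      -- Testing with `p`, which is in the kernel, leaves only `α ‖p‖²`, because `ρ` is orthogonal
      -- to `p` by symmetry.
      have hα : α = 0 := by
        have e₁ := h₃ p
        have e₂ := hσ p
        rw [hsymm, hp, inner_zero_left] at e₂
        rw [hsymm, hp, inner_zero_left] at e₁
        simp only [inner_add_left, inner_smul_left, conj_trivial, h₁', hσp, ← e₂,
          real_inner_self_eq_norm_sq] at e₁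
        have : α * ‖j p‖ ^ 2 = 0 := by linarith
        exact (mul_eq_zero.1 this).resolve_right hNp.ne'
      have hβ : β = inner ℝ ρ (j x) / ‖j σ‖ ^ 2 - a := by
        have e₁ := h₃ σ
        rw [hsymm, hσ] at e₁
        simp only [inner_add_left, inner_smul_left, conj_trivial, h₂', hpσ, haσ,
          real_inner_self_eq_norm_sq] at e₁
        rw [e₁]
        field_simp
        ring
      rw [hα, hβ] at h₃
      simpa using h₃
    · exact ⟨0, fun h => absurd h hμ⟩
  choose x hx using key
  have hB : ∀ μ ≤ 0, (κ - μ) * ‖j (x μ)‖ ^ 2 ≤ inner ℝ ρ (j (x μ)) := by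
    intro μ hμ
    obtain ⟨h₁, h₂, h₃⟩ := hx μ hμ
    have h₄ := hgap _ h₁ h₂
    rw [h₃] at h₄
    simp only [inner_add_left, inner_smul_left, conj_trivial, h₂,
      real_inner_self_eq_norm_sq] at h₄
    linarith
  have hbound : ∀ μ ≤ 0, κ * ‖j (x μ)‖ ≤ ‖ρ‖ := by
    intro μ hμ
    have h₁ := hB μ hμ
    have h₂ := real_inner_le_norm ρ (j (x μ))
    by_contra hlt
    rw [not_le] at hlt
    have hpos : 0 < ‖j (x μ)‖ := by
      by_contra hz
      have : ‖j (x μ)‖ = 0 := le_antisymm (not_lt.1 hz) (norm_nonneg _)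
      rw [this, mul_zero] at hlt
      exact absurd hlt (not_lt.2 (norm_nonneg ρ))
    nlinarith [sq_nonneg ‖j (x μ)‖, mul_lt_mul_of_pos_right hlt hpos]
  -- Resolvent identity tested with the difference `d`; the multipliers of `σ` disappear because `d
  -- ⟂ σ`.
  have hlip : ∀ μ ≤ 0, ∀ μ' ≤ 0, κ * ‖j (x μ) - j (x μ')‖ ≤ |μ - μ'| * (‖ρ‖ / κ) := by
    intro μ hμ μ' hμ'
    obtain ⟨h₁, h₂, h₃⟩ := hx μ hμ
    obtain ⟨h₁', h₂', h₃'⟩ := hx μ' hμ'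
    have hdp : inner ℝ (j p) (j (x μ - x μ')) = 0 := by
      rw [map_sub, inner_sub_right, h₁, h₁', sub_zero]
    have hdσ : inner ℝ (j σ) (j (x μ - x μ')) = 0 := by
      rw [map_sub, inner_sub_right, h₂, h₂', sub_zero]
    have h₄ := hgap _ hdp hdσ
    rw [(h₃.sub h₃') (x μ - x μ')] at h₄
    simp only [inner_add_left, inner_sub_left, inner_smul_left, conj_trivial, hdσ] at h₄
    set d := j (x μ - x μ') with hd
    have e₁ : j (x μ) = d + j (x μ') := by rw [hd, map_sub, sub_add_cancel]
    rw [show j (x μ) - j (x μ') = d by rw [hd, map_sub]]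
    rw [e₁, inner_add_left, real_inner_self_eq_norm_sq] at h₄
    have h₅ : (μ - μ') * inner ℝ (j (x μ')) d ≤ |μ - μ'| * (‖ρ‖ / κ) * ‖d‖ := by
      calc _ ≤ |(μ - μ') * inner ℝ (j (x μ')) d| := le_abs_self _
        _ = |μ - μ'| * |inner ℝ (j (x μ')) d| := abs_mul _ _
        _ ≤ |μ - μ'| * (‖j (x μ')‖ * ‖d‖) := by gcongr; exact abs_real_inner_le_norm _ _
        _ ≤ |μ - μ'| * (‖ρ‖ / κ * ‖d‖) := by
          gcongr
          rw [le_div_iff₀ hκ, mul_comm]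
          exact hbound μ' hμ'
        _ = _ := by ring
    rcases (norm_nonneg d).eq_or_lt with h0 | h0
    · rw [← h0, mul_zero]
      positivity
    · refine le_of_mul_le_mul_right ?_ h0
      nlinarith [sq_nonneg ‖d‖]
  set F : ℝ → ℝ := fun μ => inner ℝ ρ (j (x μ)) / ‖j σ‖ ^ 2 - a + μ with hF
  have hcont : ContinuousOn (fun μ => j (x μ)) (Set.Iic 0) := by
    refine LipschitzOnWith.continuousOn (K := (‖ρ‖ / κ / κ).toNNReal) ?_
    refine LipschitzOnWith.of_dist_le_mul fun μ hμ μ' hμ' => ?_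
    rw [dist_eq_norm, Real.dist_eq, Real.coe_toNNReal _ (by positivity)]
    have := hlip μ hμ μ' hμ'
    rw [← mul_le_mul_iff_right₀ hκ]
    refine this.trans (le_of_eq ?_)
    field_simp
  have hFc : ContinuousOn F (Set.Iic 0) := by
    have h₁ : ContinuousOn (fun μ => inner ℝ ρ (j (x μ))) (Set.Iic 0) :=
      continuousOn_const.inner hcont
    exact ((h₁.div_const _).sub continuousOn_const).add continuousOn_id
  have hG0 : ∀ μ ≤ 0, 0 ≤ inner ℝ ρ (j (x μ)) := fun μ hμ =>
    (mul_nonneg (by linarith) (sq_nonneg _)).trans (hB μ hμ)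
  have hG1 : ∀ μ ≤ 0, inner ℝ ρ (j (x μ)) ≤ ‖ρ‖ ^ 2 / κ := fun μ hμ => by
    refine (real_inner_le_norm _ _).trans ?_
    rw [le_div_iff₀ hκ, sq, mul_assoc]
    have := hbound μ hμ
    gcongr
    linarith
  set μ₀ := a - ‖ρ‖ ^ 2 / (κ * ‖j σ‖ ^ 2) with hμ₀
  have hμ₀' : μ₀ ≤ 0 := by
    have : 0 ≤ ‖ρ‖ ^ 2 / (κ * ‖j σ‖ ^ 2) := by positivity
    linarith
  have hle : ∀ μ ≤ 0, inner ℝ ρ (j (x μ)) / ‖j σ‖ ^ 2 ≤ ‖ρ‖ ^ 2 / (κ * ‖j σ‖ ^ 2) := fun μ hμ => by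
    rw [← div_div]
    exact div_le_div_of_nonneg_right (hG1 μ hμ) hN.le
  -- Since `0 ≤ ⟨ρ, x(μ)⟩ ≤ ‖ρ‖²/κ`, one has `F(0) ≥ -a > 0`, while the choice of `μ₀` gives `F(μ₀)
  -- ≤ 0`.
  obtain ⟨l, hl, hFl⟩ := intermediate_value_Icc hμ₀' (hFc.mono Set.Icc_subset_Iic_self)
    (show (0 : ℝ) ∈ Set.Icc (F μ₀) (F 0) by
      have h₁ := hle μ₀ hμ₀'
      have h₂ : 0 ≤ inner ℝ ρ (j (x 0)) / ‖j σ‖ ^ 2 := div_nonneg (hG0 0 le_rfl) hN.le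
      constructor
      · change inner ℝ ρ (j (x μ₀)) / ‖j σ‖ ^ 2 - a + μ₀ ≤ 0
        linarith
      · change 0 ≤ inner ℝ ρ (j (x 0)) / ‖j σ‖ ^ 2 - a + 0
        linarith)
  obtain ⟨h₁, h₂, h₃⟩ := hx l hl.2
  change inner ℝ ρ (j (x l)) / ‖j σ‖ ^ 2 - a + l = 0 at hFl
  have h₂' : 0 ≤ inner ℝ ρ (j (x l)) / ‖j σ‖ ^ 2 := div_nonneg (hG0 l hl.2) hN.le
  refine ⟨l, σ - x l, by linarith, hl.1, ?_, ?_, ?_⟩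
  · rw [map_sub, inner_sub_right, hpσ, h₁, sub_zero]
  · rw [map_sub, inner_sub_right, h₂, sub_zero, real_inner_self_eq_norm_sq]
  · have h₄ := hσ.sub h₃
    rw [show inner ℝ ρ (j (x l)) / ‖j σ‖ ^ 2 - a = -l by linarith] at h₄
    convert h₄ using 1
    rw [map_sub]
    module

end Form

/-! ## The form domain `H¹(ℝ)` -/

theorem L2R.inner_toLp (u : L2R) {f : ℝ → ℝ} (hf : MemLp f 2 (volume : Measure ℝ)) :
    inner ℝ u (hf.toLp f) = ∫ x, u x * f x := by
  rw [L2R.inner_eq]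
  refine integral_congr_ae ?_
  filter_upwards [hf.coeFn_toLp] with x hx
  rw [hx]

/-- In this form the relation is a family of continuous linear conditions, which makes the graph
`H1` closed and hence complete. -/
theorem hasWeakDeriv_iff_inner {u v : L2R} : HasWeakDeriv u v ↔
    ∀ φ : ℝ → ℝ, ContDiff ℝ ∞ φ → HasCompactSupport φ →
      ∀ (h : MemLp φ 2 (volume : Measure ℝ)) (h' : MemLp (deriv φ) 2 (volume : Measure ℝ)),
      inner ℝ u (h'.toLp _) + inner ℝ v (h.toLp _) = 0 := by
  refine forall_congr' fun φ => forall_congr' fun hφ => forall_congr' fun hc => ?_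
  have h : MemLp φ 2 (volume : Measure ℝ) := hφ.continuous.memLp_of_hasCompactSupport hc
  have h' : MemLp (deriv φ) 2 (volume : Measure ℝ) :=
    (hφ.continuous_deriv (by simp)).memLp_of_hasCompactSupport hc.deriv
  simp only [h, h', forall_true_left, L2R.inner_toLp]
  rw [eq_neg_iff_add_eq_zero]

/-- `H¹(ℝ)`, as the graph of the weak derivative. -/
def H1 : Submodule ℝ (WithLp 2 (L2R × L2R)) where
  carrier := {p | HasWeakDeriv p.fst p.snd}
  add_mem' h₁ h₂ := h₁.add h₂
  zero_mem' := HasWeakDeriv.zero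
  smul_mem' c _ h := h.smul c

theorem isClosed_H1 : IsClosed (H1 : Set (WithLp 2 (L2R × L2R))) := by
  have : (H1 : Set (WithLp 2 (L2R × L2R))) = {p | HasWeakDeriv p.fst p.snd} := rfl
  rw [this]
  simp only [hasWeakDeriv_iff_inner, Set.ofPred_forall]
  refine isClosed_iInter fun φ => isClosed_iInter fun _ => isClosed_iInter fun _ =>
    isClosed_iInter fun _ => isClosed_iInter fun _ => isClosed_eq ?_ continuous_const
  exact ((WithLp.fstL 2 ℝ L2R L2R).continuous.inner continuous_const).add
    ((WithLp.sndL 2 ℝ L2R L2R).continuous.inner continuous_const)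

instance : CompleteSpace H1 := isClosed_H1.completeSpace_coe

namespace H1

/-- The element of `H¹(ℝ)` given by a function and its weak derivative. -/
def mk {u v : L2R} (h : HasWeakDeriv u v) : H1 := ⟨WithLp.toLp 2 (u, v), h⟩

/-- The inclusion of `H¹(ℝ)` in `L²(ℝ)`. -/
def val : H1 →L[ℝ] L2R := WithLp.fstL 2 ℝ L2R L2R ∘L H1.subtypeL

/-- The weak derivative on `H¹(ℝ)`. -/
def der : H1 →L[ℝ] L2R := WithLp.sndL 2 ℝ L2R L2R ∘L H1.subtypeL

theorem val_mk {u v : L2R} (h : HasWeakDeriv u v) : val (mk h) = u := rfl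

theorem der_mk {u v : L2R} (h : HasWeakDeriv u v) : der (mk h) = v := rfl

theorem hasWeakDeriv (v : H1) : HasWeakDeriv (val v) (der v) := v.2

theorem norm_sq (v : H1) : ‖v‖ ^ 2 = ‖val v‖ ^ 2 + ‖der v‖ ^ 2 :=
  WithLp.prod_norm_sq_eq_of_L2 (v : WithLp 2 (L2R × L2R))

end H1

/-! ## The energy form -/

theorem mass_pos (h1 : ν < 1) : 0 < mass ν := by
  unfold mass
  linarith

theorem abs_scaledPot_le (h0 : 0 < ν) (h1 : ν < 1) (x : ℝ) : |scaledPot ν x| ≤ 16 := by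
  have p0 := prof_pos ν x
  have p1 := prof_le_one ν x
  have a₁ : prof ν x ^ 2 ≤ 1 := pow_le_one₀ p0.le p1
  have a₂ : (1 - ν) * prof ν x ^ 2 ≤ 1 := mul_le_one₀ (by linarith) (sq_nonneg _) a₁
  have a₃ : 0 ≤ (1 - ν) * prof ν x ^ 2 := mul_nonneg (by linarith) (sq_nonneg _)
  rw [scaledPot, abs_le]
  constructor <;> linarith

theorem abs_potential_le (h0 : 0 < ν) (h1 : ν < 1) (x : ℝ) : |potential ν x| ≤ 3 := by
  rw [potential_eq h1, abs_mul, abs_of_pos (mass_pos h1)]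
  have := abs_scaledPot_le h0 h1 x
  have : mass ν ≤ 3 / 16 := by
    unfold mass
    linarith
  nlinarith [mass_pos h1, abs_nonneg (scaledPot ν x)]

/-- Multiplication by the potential as a bounded operator. -/
def potentialCLM (ν : ℝ) : L2R →L[ℝ] L2R :=
  (potentialMul ν).mkContinuous ‖(memLp_potential ν).toLp (potential ν)‖ fun u =>
    Lp.norm_smul_le ((memLp_potential ν).toLp (potential ν)) u

theorem norm_potentialMul_le (h0 : 0 < ν) (h1 : ν < 1) (u : L2R) :
    ‖potentialMul ν u‖ ≤ 3 * ‖u‖ := by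
  refine Lp.norm_le_mul_norm_of_ae_le_mul ?_
  filter_upwards [potentialMul_coe ν u] with x hx
  rw [hx, norm_mul]
  exact mul_le_mul_of_nonneg_right (abs_potential_le h0 h1 x) (norm_nonneg _)

theorem inner_potentialMul (u v : L2R) :
    inner ℝ (potentialMul ν u) v = ∫ x, potential ν x * (u x * v x) := by
  rw [L2R.inner_eq]
  refine integral_congr_ae ?_
  filter_upwards [potentialMul_coe ν u] with x hx
  rw [hx, mul_assoc]

/-- The quadratic form of `A`. -/
def energy (ν : ℝ) : H1 →L[ℝ] H1 →L[ℝ] ℝ :=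
  mass ν • (innerBilin L2R).bilinearComp H1.der H1.der +
    (innerBilin L2R).bilinearComp (potentialCLM ν ∘L H1.val) H1.val

theorem energy_apply (v w : H1) : energy ν v w =
    mass ν * inner ℝ (H1.der v) (H1.der w) +
      inner ℝ (potentialMul ν (H1.val v)) (H1.val w) := rfl

theorem energy_symm (v w : H1) : energy ν v w = energy ν w v := by
  rw [energy_apply, energy_apply, inner_potentialMul, inner_potentialMul,
    real_inner_comm (H1.der v)]
  simp_rw [mul_comm (H1.val v _)]

/-- The constant 4 is the bound 3 for the potential plus a bound 1 for the mass. -/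
theorem energy_garding (h0 : 0 < ν) (h1 : ν < 1) (v : H1) :
    mass ν * ‖v‖ ^ 2 ≤ energy ν v v + 4 * ‖H1.val v‖ ^ 2 := by
  rw [energy_apply, H1.norm_sq, real_inner_self_eq_norm_sq]
  have h₁ := abs_le.1 (abs_real_inner_le_norm (potentialMul ν (H1.val v)) (H1.val v))
  have h₂ := mul_le_mul_of_nonneg_right (norm_potentialMul_le h0 h1 (H1.val v))
    (norm_nonneg (H1.val v))
  have h₃ : mass ν * ‖H1.val v‖ ^ 2 ≤ 1 * ‖H1.val v‖ ^ 2 := by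
    gcongr
    unfold mass
    linarith
  linarith [h₁.1]

theorem opA_apply {u u' u'' : L2R} (h : HasWeakDeriv u u') (h' : HasWeakDeriv u' u'')
    (hu : u ∈ (opA ν).domain) : opA ν ⟨u, hu⟩ = -(mass ν • u'') + potentialMul ν u := by
  change -(mass ν • weakDeriv (weakDeriv u)) + potentialMul ν u = _
  rw [h.weakDeriv_eq, h'.weakDeriv_eq]

theorem isWeakSolution_of_opA {v : H1} (h : H1.val v ∈ (opA ν).domain) :
    IsWeakSolution H1.val (energy ν) v (opA ν ⟨H1.val v, h⟩) := by
  obtain ⟨u', u'', h₁, h₂⟩ := id h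
  intro w
  rw [opA_apply h₁ h₂ h, energy_apply, (H1.hasWeakDeriv v).unique h₁, inner_add_left,
    inner_neg_left, inner_smul_left, h₂.inner_eq_neg (H1.hasWeakDeriv w)]
  simp

/-- Regularity is immediate in one dimension: tested with smooth functions, the weak equation says
that the derivative of `v` has weak derivative `(V v - f) / m`. -/
theorem IsWeakSolution.exists_opA (h1 : ν < 1) {v : H1} {f : L2R}
    (h : IsWeakSolution H1.val (energy ν) v f) :
    ∃ hv : H1.val v ∈ (opA ν).domain, opA ν ⟨H1.val v, hv⟩ = f := by
  have hm := mass_pos h1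
  have hd : HasWeakDeriv (H1.der v) ((mass ν)⁻¹ • (potentialMul ν (H1.val v) - f)) := by
    rw [hasWeakDeriv_iff_inner]
    intro φ hφ hc i i'
    have hw : HasWeakDeriv (i.toLp φ) (i'.toLp (deriv φ)) := hasWeakDeriv_toLp i i'
      (fun x => (hφ.differentiable (by simp) x).hasDerivAt) (hφ.continuous_deriv (by simp))
    have := h (H1.mk hw)
    rw [energy_apply, H1.val_mk, H1.der_mk] at this
    rw [inner_smul_left, inner_sub_left, conj_trivial, ← this]
    field_simp
    ring
  refine ⟨⟨_, _, H1.hasWeakDeriv v, hd⟩, (opA_apply (H1.hasWeakDeriv v) hd _).trans ?_⟩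
  rw [smul_smul, mul_inv_cancel₀ hm.ne', one_smul]
  abel

theorem exists_H1_val_eq {u : L2R} (hu : u ∈ (opA ν).domain) : ∃ v : H1, H1.val v = u := by
  obtain ⟨u', _, h, _⟩ := hu
  exact ⟨H1.mk h, rfl⟩

/-- The equation expresses `u''` through `u` and `A u`, with `m ≥ 1/8`; then `‖u'‖² ≤ ‖u''‖ ‖u‖` by
parts. -/
theorem H2norm_le (h0 : 0 < ν) (h1 : ν ≤ 1 / 10) {u : L2R} (hu : u ∈ (opA ν).domain) :
    H2norm u ≤ 8 * ‖opA ν ⟨u, hu⟩‖ + 25 * ‖u‖ := by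
  have hm : 1 / 8 ≤ mass ν := by
    unfold mass
    linarith
  obtain ⟨u', u'', h₁, h₂⟩ := id hu
  rw [H2norm, h₁.weakDeriv_eq, h₂.weakDeriv_eq]
  have e : mass ν • u'' = potentialMul ν u - opA ν ⟨u, hu⟩ := by
    rw [opA_apply h₁ h₂]
    abel
  have n₁ : mass ν * ‖u''‖ ≤ 3 * ‖u‖ + ‖opA ν ⟨u, hu⟩‖ := by
    rw [← Real.norm_of_nonneg (by linarith : 0 ≤ mass ν), ← norm_smul, e]
    exact (norm_sub_le _ _).trans
      (add_le_add_left (norm_potentialMul_le h0 (by linarith) u) _)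
  have n₂ : ‖u''‖ ≤ 24 * ‖u‖ + 8 * ‖opA ν ⟨u, hu⟩‖ := by
    have := mul_le_mul_of_nonneg_right hm (norm_nonneg u'')
    linarith
  have n₃ : ‖u'‖ ^ 2 ≤ ‖u''‖ * ‖u‖ := by
    have h := h₂.inner_eq_neg h₁
    rw [real_inner_self_eq_norm_sq] at h
    have := abs_le.1 (abs_real_inner_le_norm u'' u)
    linarith [this.1]
  refine (Real.sqrt_le_iff.2 ⟨?_, ?_⟩ : _ ≤ ‖u‖ + ‖u''‖).trans (by linarith)
  · positivity
  · nlinarith [mul_nonneg (norm_nonneg u) (norm_nonneg u'')]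

/-! ## The spectral gap in the sense of forms -/

theorem L2R.norm_sq_eq (u : L2R) : ‖u‖ ^ 2 = ∫ x, u x ^ 2 := by
  rw [← real_inner_self_eq_norm_sq, L2R.inner_eq]
  simp_rw [sq]

theorem energy_ge_of_dirichlet (h0 : 0 < ν) (h1 : √ν ≤ 1 / 1000) {x₀ : ℝ} (hx₀ : 0 ≤ x₀)
    (hp : prof ν x₀ = 1 / 3) {v : H1} {W : ℝ → ℝ} (hW : IsPrimitive W (H1.der v))
    (e : W =ᵐ[volume] H1.val v) (hr : W x₀ = 0) (hl : W (-x₀) = 0) :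
    mass ν / 50 * ‖H1.val v‖ ^ 2 ≤ energy ν v v := by
  have hν : ν < 1 := by
    have := Real.sq_sqrt h0.le
    nlinarith [Real.sqrt_nonneg ν]
  have i₁ : Integrable fun x => H1.val v x ^ 2 := (Lp.memLp (H1.val v)).integrable_sq
  have i₂ : Integrable fun x => H1.der v x ^ 2 := (Lp.memLp (H1.der v)).integrable_sq
  have e₁ : (fun x => W x ^ 2) =ᵐ[volume] fun x => H1.val v x ^ 2 := by
    filter_upwards [e] with x hx
    rw [hx]
  have i₃ : Integrable fun x => scaledPot ν x * H1.val v x ^ 2 :=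
    i₁.bdd_mul (continuous_scaledPot ν).aestronglyMeasurable
      (Eventually.of_forall (abs_scaledPot_le h0 hν))
  have h := dirichlet_bound h0 h1 hx₀ hp hW (i₁.congr e₁.symm) i₂
    ((L2R.integrable_mul_mul (H1.val v) (H1.der v)).congr (by
      filter_upwards [e] with x hx
      rw [hx])) hr hl
  have e₂ : ∫ x, (H1.der v x ^ 2 + (scaledPot ν x - 1 / 50) * W x ^ 2) =
      ∫ x, (H1.der v x ^ 2 + (scaledPot ν x * H1.val v x ^ 2 - 1 / 50 * H1.val v x ^ 2)) := by
    refine integral_congr_ae ?_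
    filter_upwards [e] with x hx
    rw [hx]
    ring
  have i₄ : Integrable fun x =>
      scaledPot ν x * H1.val v x ^ 2 - 1 / 50 * H1.val v x ^ 2 := i₃.sub (i₁.const_mul _)
  rw [e₂, integral_add i₂ i₄, integral_sub i₃ (i₁.const_mul _),
    integral_const_mul, ← L2R.norm_sq_eq, ← L2R.norm_sq_eq] at h
  have e₃ : energy ν v v = mass ν * ‖H1.der v‖ ^ 2 +
      mass ν * ∫ x, scaledPot ν x * H1.val v x ^ 2 := by
    rw [energy_apply, real_inner_self_eq_norm_sq, inner_potentialMul, ← integral_const_mul]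
    congr 2
    funext x
    rw [potential_eq hν]
    ring
  rw [e₃]
  have := mul_nonneg (mass_pos hν).le h
  linarith

/-- The translation mode `r'` as an element of `H¹(ℝ)`. -/
def translationMode (h0 : 0 < ν) (h1 : ν < 1) : H1 :=
  H1.mk (hasWeakDeriv_toLp (memLp_pulseDeriv h0 h1) (memLp_pulseDeriv₂ h0 h1)
    (hasDerivAt_pulseDeriv h0 h1) (continuous_pulseDeriv₂ ν))

/-- The function `σ` as an element of `H¹(ℝ)`. -/
def breathingMode (h0 : 0 < ν) (h1 : ν < 1) : H1 :=
  H1.mk (hasWeakDeriv_toLp (memLp_sigma h0 h1) (memLp_sigmaDeriv h0 h1)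
    (hasDerivAt_sigma h0 h1) (continuous_sigmaDeriv ν))

theorem translationMode_mem (h0 : 0 < ν) (h1 : ν < 1) :
    IsWeakSolution H1.val (energy ν) (translationMode h0 h1) 0 := by
  have h₁ := hasWeakDeriv_toLp (memLp_pulseDeriv h0 h1) (memLp_pulseDeriv₂ h0 h1)
    (hasDerivAt_pulseDeriv h0 h1) (continuous_pulseDeriv₂ ν)
  have h₂ := hasWeakDeriv_toLp (memLp_pulseDeriv₂ h0 h1) (memLp_pulseDeriv₃ h0 h1)
    (hasDerivAt_pulseDeriv₂ h1) ((continuous_scaledPot ν).mul (continuous_pulseDeriv ν))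
  have hd : H1.val (translationMode h0 h1) ∈ (opA ν).domain := ⟨_, _, h₁, h₂⟩
  have h := isWeakSolution_of_opA hd
  convert h
  symm
  refine (opA_apply h₁ h₂ hd).trans ?_
  rw [neg_add_eq_zero]
  apply Lp.ext
  filter_upwards [potentialMul_coe ν ((memLp_pulseDeriv h0 h1).toLp _),
    Lp.coeFn_smul (mass ν) ((memLp_pulseDeriv₃ h0 h1).toLp _), (memLp_pulseDeriv h0 h1).coeFn_toLp,
    (memLp_pulseDeriv₃ h0 h1).coeFn_toLp] with x a b c d
  rw [a, b, Pi.smul_apply, c, d, potential_eq h1, smul_eq_mul]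
  ring

theorem breathingMode_mem (h0 : 0 < ν) (h1 : ν < 1) :
    IsWeakSolution H1.val (energy ν) (breathingMode h0 h1)
      ((memLp_rho h0 h1).toLp (rho ν)) := by
  have h₁ := hasWeakDeriv_toLp (memLp_sigma h0 h1) (memLp_sigmaDeriv h0 h1)
    (hasDerivAt_sigma h0 h1) (continuous_sigmaDeriv ν)
  have h₂ := hasWeakDeriv_toLp (memLp_sigmaDeriv h0 h1) (memLp_sigmaDeriv₂ h0 h1)
    (hasDerivAt_sigmaDeriv h0 h1) (continuous_sigmaDeriv₂ ν)
  have hd : H1.val (breathingMode h0 h1) ∈ (opA ν).domain := ⟨_, _, h₁, h₂⟩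
  have h := isWeakSolution_of_opA hd
  convert h
  symm
  refine (opA_apply h₁ h₂ hd).trans ?_
  apply Lp.ext
  filter_upwards [potentialMul_coe ν ((memLp_sigma h0 h1).toLp _),
    Lp.coeFn_add (-(mass ν • (memLp_sigmaDeriv₂ h0 h1).toLp _))
      (potentialMul ν ((memLp_sigma h0 h1).toLp _)),
    Lp.coeFn_neg (mass ν • (memLp_sigmaDeriv₂ h0 h1).toLp _),
    Lp.coeFn_smul (mass ν) ((memLp_sigmaDeriv₂ h0 h1).toLp _), (memLp_sigma h0 h1).coeFn_toLp,
    (memLp_sigmaDeriv₂ h0 h1).coeFn_toLp, (memLp_rho h0 h1).coeFn_toLp] with x a b c d e f g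
  rw [b, Pi.add_apply, c, Pi.neg_apply, d, a, Pi.smul_apply, e, f, g, ← opA_sigma_eq_rho h1 h0,
    smul_eq_mul]
  ring

theorem tanhTwo_neg (x : ℝ) : tanhTwo (-x) = -tanhTwo x := by
  simp [tanhTwo, neg_div]

theorem pulse_neg (ν x : ℝ) : pulse ν (-x) = pulse ν x := by
  rw [pulse_eq, pulse_eq, prof_neg]

theorem pulseDeriv_neg (ν x : ℝ) : pulseDeriv ν (-x) = -pulseDeriv ν x := by
  rw [pulseDeriv, pulseDeriv, pulse_neg, prof_neg, tanhTwo_neg]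
  ring

theorem sigma_neg (h0 : 0 < ν) (h1 : ν < 1) (x : ℝ) : sigma ν (-x) = sigma ν x := by
  rw [sigma_eq h0 h1, sigma_eq h0 h1, pulse_neg, prof_neg]

theorem inner_translationMode_breathingMode (h0 : 0 < ν) (h1 : ν < 1) :
    inner ℝ (H1.val (translationMode h0 h1)) (H1.val (breathingMode h0 h1)) = 0 := by
  have e : inner ℝ (H1.val (translationMode h0 h1)) (H1.val (breathingMode h0 h1)) =
      ∫ x, pulseDeriv ν x * sigma ν x := by
    refine (L2R.inner_toLp _ (memLp_sigma h0 h1)).trans (integral_congr_ae ?_)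
    filter_upwards [(memLp_pulseDeriv h0 h1).coeFn_toLp] with x hx
    exact congrArg (· * sigma ν x) hx
  rw [e]
  have h := integral_neg_eq_self (fun x => pulseDeriv ν x * sigma ν x) volume
  simp_rw [pulseDeriv_neg, sigma_neg h0 h1, neg_mul, integral_neg] at h
  linarith

theorem norm_sq_breathingMode (h0 : 0 < ν) (h1 : ν < 1) :
    ‖H1.val (breathingMode h0 h1)‖ ^ 2 = ∫ x, sigma ν x * sigma ν x := by
  rw [← real_inner_self_eq_norm_sq]
  refine (L2R.inner_toLp _ (memLp_sigma h0 h1)).trans (integral_congr_ae ?_)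
  filter_upwards [(memLp_sigma h0 h1).coeFn_toLp] with x hx
  exact congrArg (· * sigma ν x) hx

theorem inner_rho_breathingMode (h0 : 0 < ν) (h1 : ν < 1) :
    inner ℝ ((memLp_rho h0 h1).toLp (rho ν)) (H1.val (breathingMode h0 h1)) =
      ∫ x, sigma ν x * rho ν x := by
  refine (L2R.inner_toLp _ (memLp_sigma h0 h1)).trans (integral_congr_ae ?_)
  filter_upwards [(memLp_rho h0 h1).coeFn_toLp] with x hx
  rw [hx, mul_comm]

theorem norm_sq_rho (h0 : 0 < ν) (h1 : ν < 1) :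
    ‖(memLp_rho h0 h1).toLp (rho ν)‖ ^ 2 = ∫ x, rho ν x * rho ν x := by
  rw [← real_inner_self_eq_norm_sq, L2R.inner_toLp]
  refine integral_congr_ae ?_
  filter_upwards [(memLp_rho h0 h1).coeFn_toLp] with x hx
  rw [hx]

/-- For `v` orthogonal to `r'` and `σ`, put `W = v - a r' - b σ` with `W(±x₀) = 0`. Orthogonality
gives `‖W‖² ≥ ‖v‖² + b² ‖σ‖²`. The energy changes only by `-2b ⟨ρ, v⟩ + b² ⟨ρ, σ⟩`, whose last term
is nonpositive. Half of the bound `1/300` is spent on the cross term. -/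
theorem formGap_energy (h0 : 0 < ν) (h1 : ν < 1) (hs : √ν ≤ 1 / 1000) :
    FormGap H1.val (energy ν) (H1.val (translationMode h0 h1)) (H1.val (breathingMode h0 h1))
      (1 / 600) := by
  have hs0 := Real.sqrt_pos.2 h0
  have hν := Real.sq_sqrt h0.le
  intro v hp hσ
  obtain ⟨x₀, hx₀, hx⟩ := exists_prof_eq h0 h1.le
  obtain ⟨U, hU, hUp⟩ := (H1.hasWeakDeriv v).exists_isPrimitive
  set p := translationMode h0 h1 with hpdef
  set q := breathingMode h0 h1 with hqdef
  set ρ := (memLp_rho h0 h1).toLp (rho ν) with hρdef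
  have hx₀' : x₀ ≠ 0 := by
    rintro rfl
    rw [prof, mul_zero, Real.cosh_zero, div_eq_div_iff (by linarith) (by norm_num)] at hx
    linarith
  have ht : tanhTwo x₀ ≠ 0 := by
    rw [tanhTwo]
    exact div_ne_zero (by rw [Ne, Real.sinh_eq_zero]; simpa using hx₀') (Real.cosh_pos _).ne'
  have hr : pulseDeriv ν x₀ ≠ 0 := by
    rw [pulseDeriv, hx]
    exact mul_ne_zero (pulse_pos h1 x₀).ne' (neg_ne_zero.2 (mul_ne_zero ht (by norm_num)))
  have hσ₀ : sigma ν x₀ ≠ 0 := by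
    rw [sigma_eq h0 h1, hx]
    have : 1 ≤ (1 + ν) / (1 - ν) := by
      rw [le_div_iff₀ (by linarith)]
      linarith
    exact mul_ne_zero (pulse_pos h1 x₀).ne' (by linarith)
  -- As `r'` is odd and `σ` is even, `a` matches the odd part of the values at `±x₀` and `b` the
  -- even part.
  set a := (U x₀ - U (-x₀)) / (2 * pulseDeriv ν x₀) with ha
  set b := (U x₀ + U (-x₀)) / (2 * sigma ν x₀) with hb
  have ha' : a * pulseDeriv ν x₀ = (U x₀ - U (-x₀)) / 2 := by
    rw [ha]
    field_simp
  have hb' : b * sigma ν x₀ = (U x₀ + U (-x₀)) / 2 := by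
    rw [hb]
    field_simp
  have hP := (IsPrimitive.of_hasDerivAt (hasDerivAt_pulseDeriv h0 h1)
    (continuous_pulseDeriv₂ ν)).const_mul (-a)
  have hS := (IsPrimitive.of_hasDerivAt (hasDerivAt_sigma h0 h1)
    (continuous_sigmaDeriv ν)).const_mul (-b)
  have hWp := (hUp.add hP).add hS
  have hder : (fun x => H1.der v x + -a * pulseDeriv₂ ν x + -b * sigmaDeriv ν x) =ᵐ[volume]
      H1.der (v + (-a) • p + (-b) • q) := by
    rw [map_add, map_add, map_smul, map_smul]
    filter_upwards [Lp.coeFn_add (H1.der v + (-a) • H1.der p) ((-b) • H1.der q),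
      Lp.coeFn_add (H1.der v) ((-a) • H1.der p), Lp.coeFn_smul (-a) (H1.der p),
      Lp.coeFn_smul (-b) (H1.der q), (memLp_pulseDeriv₂ h0 h1).coeFn_toLp,
      (memLp_sigmaDeriv h0 h1).coeFn_toLp] with x e₁ e₂ e₃ e₄ e₅ e₆
    rw [e₁, Pi.add_apply, e₂, Pi.add_apply, e₃, e₄, Pi.smul_apply, Pi.smul_apply, ← e₅, ← e₆]
    rfl
  have hval : (fun x => U x + -a * pulseDeriv ν x + -b * sigma ν x) =ᵐ[volume]
      H1.val (v + (-a) • p + (-b) • q) := by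
    rw [map_add, map_add, map_smul, map_smul]
    filter_upwards [Lp.coeFn_add (H1.val v + (-a) • H1.val p) ((-b) • H1.val q),
      Lp.coeFn_add (H1.val v) ((-a) • H1.val p), Lp.coeFn_smul (-a) (H1.val p),
      Lp.coeFn_smul (-b) (H1.val q), (memLp_pulseDeriv h0 h1).coeFn_toLp,
      (memLp_sigma h0 h1).coeFn_toLp, hU] with x e₁ e₂ e₃ e₄ e₅ e₆ e₇
    rw [e₁, Pi.add_apply, e₂, Pi.add_apply, e₃, e₄, Pi.smul_apply, Pi.smul_apply, ← e₅, ← e₆, e₇]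
    rfl
  have key := energy_ge_of_dirichlet h0 hs hx₀ hx (hWp.congr_ae hder) hval
    (by linarith) (by rw [pulseDeriv_neg, sigma_neg h0 h1]; linarith)
  have hpq : inner ℝ (H1.val p) (H1.val q) = 0 := inner_translationMode_breathingMode h0 h1
  have hEp : ∀ w, energy ν p w = 0 := fun w => by
    rw [translationMode_mem h0 h1, inner_zero_left]
  have hEq : ∀ w, energy ν q w = inner ℝ ρ (H1.val w) := breathingMode_mem h0 h1
  have hρσ : inner ℝ ρ (H1.val q) ≤ 0 := by
    have := abs_le.1 (integral_sigma_mul_rho h0 hs)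
    rw [inner_rho_breathingMode h0 h1]
    nlinarith [this.2]
  have hσn : 1 / 4 ≤ ‖H1.val q‖ ^ 2 := by
    have := abs_le.1 (integral_sigma_sq h0 hs)
    rw [norm_sq_breathingMode h0 h1]
    linarith [this.1]
  have hρn : ‖ρ‖ ^ 2 ≤ 1 / 10000000 := by
    have hν1 : ν ≤ 1 / 1000000 := by nlinarith
    rw [norm_sq_rho h0 h1]
    refine (integral_rho_sq_le h0 (by linarith)).trans ?_
    have hL := shelf_le h0
    rw [le_div_iff₀ hs0] at hL
    have : ν ^ 2 * shelf ν = ν * √ν * (shelf ν * √ν) := by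
      linear_combination (-ν * shelf ν) * hν
    rw [this]
    have hL0 : 0 ≤ shelf ν := (by norm_num : (0 : ℝ) ≤ 1 / 3).trans (shelf_ge h0 h1.le)
    calc 100 * (ν * √ν * (shelf ν * √ν)) ≤ 100 * (1 / 1000000 * (1 / 1000) * 1) := by gcongr
      _ = _ := by norm_num
  have hn : ‖H1.val (v + (-a) • p + (-b) • q)‖ ^ 2 =
      ‖H1.val v‖ ^ 2 + a ^ 2 * ‖H1.val p‖ ^ 2 + b ^ 2 * ‖H1.val q‖ ^ 2 := by
    have hp' : inner ℝ (H1.val v) (H1.val p) = 0 := by rw [real_inner_comm, hp]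
    have hσ' : inner ℝ (H1.val v) (H1.val q) = 0 := by rw [real_inner_comm, hσ]
    have hpq' : inner ℝ (H1.val q) (H1.val p) = 0 := by rw [real_inner_comm, hpq]
    rw [← real_inner_self_eq_norm_sq, map_add, map_add, map_smul, map_smul]
    simp only [inner_add_left, inner_add_right, inner_smul_left, inner_smul_right, hp, hσ, hp',
      hσ', hpq, hpq', real_inner_self_eq_norm_sq, conj_trivial]
    ring
  have hE : energy ν (v + (-a) • p + (-b) • q) (v + (-a) • p + (-b) • q) =
      energy ν v v - 2 * b * inner ℝ ρ (H1.val v) + b ^ 2 * inner ℝ ρ (H1.val q) := by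
    simp only [map_add, map_smul, add_apply, smul_apply, smul_eq_mul,
      energy_symm v p, energy_symm v q, energy_symm q p, hEp, hEq]
    ring
  have hm : 1 / 6 ≤ mass ν := by
    unfold mass
    nlinarith
  rw [hn, hE] at key
  have h₁ : 1 / 300 * (‖H1.val v‖ ^ 2 + a ^ 2 * ‖H1.val p‖ ^ 2 + b ^ 2 * ‖H1.val q‖ ^ 2) ≤
      mass ν / 50 * (‖H1.val v‖ ^ 2 + a ^ 2 * ‖H1.val p‖ ^ 2 + b ^ 2 * ‖H1.val q‖ ^ 2) :=
    mul_le_mul_of_nonneg_right (by linarith) (by positivity)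
  have h₂ : 0 ≤ a ^ 2 * ‖H1.val p‖ ^ 2 := by positivity
  have h₃ : b ^ 2 * (1 / 4) ≤ b ^ 2 * ‖H1.val q‖ ^ 2 := by gcongr
  have h₄ : b ^ 2 * ‖ρ‖ ^ 2 ≤ b ^ 2 * (1 / 10000000) := by gcongr
  have h₅ : b ^ 2 * inner ℝ ρ (H1.val q) ≤ 0 :=
    mul_nonpos_of_nonneg_of_nonpos (sq_nonneg b) hρσ
  have h₆ : -(|b| * (‖ρ‖ * ‖H1.val v‖)) ≤ b * inner ℝ ρ (H1.val v) := by
    refine le_trans ?_ (neg_abs_le _)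
    rw [abs_mul]
    have := abs_real_inner_le_norm ρ (H1.val v)
    gcongr
  -- Young's inequality with weight 600. The term in `b²` is absorbed by `b² ‖σ‖² / 300`, since
  -- `‖ρ‖² ≤ 10⁻⁷`.
  have h₇ : 2 * (|b| * (‖ρ‖ * ‖H1.val v‖)) ≤
      600 * (b ^ 2 * ‖ρ‖ ^ 2) + 1 / 600 * ‖H1.val v‖ ^ 2 := by
    have := sq_nonneg (600 * (|b| * ‖ρ‖) - ‖H1.val v‖)
    have hbb : (|b| * ‖ρ‖) ^ 2 = b ^ 2 * ‖ρ‖ ^ 2 := by rw [mul_pow, sq_abs]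
    rw [← hbb, ← mul_assoc |b|]
    linarith
  linarith [sq_nonneg b]

/-! ## The equation `A u = f` -/

/-- `u` is in the domain of `A` and `A u = f`. -/
def OpEq (ν : ℝ) (u f : L2R) : Prop := ∃ h : u ∈ (opA ν).domain, opA ν ⟨u, h⟩ = f

theorem OpEq.add {u v f g : L2R} (hu : OpEq ν u f) (hv : OpEq ν v g) :
    OpEq ν (u + v) (f + g) := by
  obtain ⟨h₁, rfl⟩ := hu
  obtain ⟨h₂, rfl⟩ := hv
  exact ⟨(opA ν).domain.add_mem h₁ h₂, (opA ν).map_add ⟨u, h₁⟩ ⟨v, h₂⟩⟩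

theorem OpEq.smul {u f : L2R} (c : ℝ) (hu : OpEq ν u f) : OpEq ν (c • u) (c • f) := by
  obtain ⟨h₁, rfl⟩ := hu
  exact ⟨(opA ν).domain.smul_mem c h₁, (opA ν).map_smul c ⟨u, h₁⟩⟩

theorem OpEq.sub {u v f g : L2R} (hu : OpEq ν u f) (hv : OpEq ν v g) :
    OpEq ν (u - v) (f - g) := by
  have := hu.add (hv.smul (-1))
  simpa [sub_eq_add_neg] using this

theorem OpEq.isWeakSolution {v : H1} {f : L2R} (h : OpEq ν (H1.val v) f) :
    IsWeakSolution H1.val (energy ν) v f := by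
  obtain ⟨h₁, rfl⟩ := h
  exact isWeakSolution_of_opA h₁

theorem OpEq.exists_H1 {u f : L2R} (h : OpEq ν u f) :
    ∃ v : H1, H1.val v = u ∧ IsWeakSolution H1.val (energy ν) v f := by
  obtain ⟨v, rfl⟩ := exists_H1_val_eq h.1
  exact ⟨v, rfl, h.isWeakSolution⟩

theorem OpEq.inner_comm {u v f g : L2R} (hu : OpEq ν u f) (hv : OpEq ν v g) :
    inner ℝ f v = inner ℝ u g := by
  obtain ⟨u, rfl, h₁⟩ := hu.exists_H1
  obtain ⟨v, rfl, h₂⟩ := hv.exists_H1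
  rw [← h₁ v, energy_symm, h₂ u, real_inner_comm]

theorem IsWeakSolution.opEq (h1 : ν < 1) {v : H1} {f : L2R}
    (h : IsWeakSolution H1.val (energy ν) v f) : OpEq ν (H1.val v) f := h.exists_opA h1

theorem OpEq.H2norm_le (h0 : 0 < ν) (h1 : ν ≤ 1 / 10) {u f : L2R} (h : OpEq ν u f) :
    H2norm u ≤ 8 * ‖f‖ + 25 * ‖u‖ := by
  obtain ⟨h₁, rfl⟩ := h
  exact PulseOperator.H2norm_le h0 h1 h₁

/-! ## The resolvent set below the form -/

/-- Lax–Milgram without constraints gives a solution, and testing the equation with it gives `(l -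
μ) ‖u‖ ≤ ‖f‖`, hence uniqueness, linearity and boundedness of the inverse. -/
theorem mem_opResolventSet (h0 : 0 < ν) (h1 : ν < 1) {l μ : ℝ} (hμ : μ < l)
    (hl : ∀ v : H1, l * ‖H1.val v‖ ^ 2 ≤ energy ν v v) : μ ∈ opResolventSet (opA ν) := by
  have hm := mass_pos h1
  have hex : ∀ f : L2R, ∃ u, OpEq ν u (f + μ • u) := fun f => by
    obtain ⟨v, α, β, -, -, hv⟩ := exists_inner_eq_zero_of_formGap hm (energy_garding h0 h1)
      (p := 0) (q := 0) (by simp) (fun v _ _ => hl v) hμ f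
    rw [map_zero, smul_zero, smul_zero, add_zero, add_zero] at hv
    exact ⟨_, hv.opEq h1⟩
  have hbd : ∀ u f : L2R, OpEq ν u (f + μ • u) → (l - μ) * ‖u‖ ≤ ‖f‖ := fun u f h => by
    obtain ⟨v, rfl, hv⟩ := h.exists_H1
    have h₁ := hl v
    rw [hv v, inner_add_left, inner_smul_left, real_inner_self_eq_norm_sq, conj_trivial] at h₁
    have h₂ := real_inner_le_norm f (H1.val v)
    rcases (norm_nonneg (H1.val v)).eq_or_lt with h | h
    · rw [← h, mul_zero]
      exact norm_nonneg f
    · refine le_of_mul_le_mul_right ?_ h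
      linarith
  have huniq : ∀ u v f : L2R, OpEq ν u (f + μ • u) → OpEq ν v (f + μ • v) → u = v := by
    intro u v f hu hv
    have h := hu.sub hv
    rw [show f + μ • u - (f + μ • v) = 0 + μ • (u - v) by module] at h
    have := hbd _ _ h
    rw [norm_zero] at this
    rw [← sub_eq_zero, ← norm_le_zero_iff]
    exact nonpos_of_mul_nonpos_right this (sub_pos.2 hμ)
  choose S hS using hex
  let SL : L2R →ₗ[ℝ] L2R :=
    { toFun := S
      map_add' := fun f g => huniq _ _ (f + g) (hS _) (by
        have := (hS f).add (hS g)
        rwa [show f + μ • S f + (g + μ • S g) = f + g + μ • (S f + S g) by module] at this)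
      map_smul' := fun c f => huniq _ _ (c • f) (hS _) (by
        have := (hS f).smul c
        rwa [show c • (f + μ • S f) = c • f + μ • (c • S f) by module] at this) }
  refine ⟨SL.mkContinuous (l - μ)⁻¹ fun f => ?_, fun f => ?_, fun u => ?_⟩
  · rw [inv_mul_eq_div, le_div_iff₀ (sub_pos.2 hμ), mul_comm]
    exact hbd _ _ (hS f)
  · obtain ⟨h, e⟩ := hS f
    exact ⟨⟨S f, h⟩, rfl, by rw [e, add_sub_cancel_right]⟩
  · exact huniq _ _ (opA ν u - μ • (u : L2R)) (hS _) ⟨u.2, by rw [sub_add_cancel]⟩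

/-! ## Spectral decomposition at the bottom of the spectrum -/

/-- `p` and `e` span the kernel of `A` and the eigenspace of `A` for its lowest eigenvalue `l`,
and `A` is bounded below by `κ` on their orthogonal complement. -/
structure IsBottom (ν l κ : ℝ) (p e : H1) : Prop where
  neg : l < 0
  pos : 0 < κ
  opEq_p : OpEq ν (H1.val p) 0
  opEq_e : OpEq ν (H1.val e) (l • H1.val e)
  orth : inner ℝ (H1.val p) (H1.val e) = 0
  p_ne : H1.val p ≠ 0
  e_ne : H1.val e ≠ 0
  gap : FormGap H1.val (energy ν) (H1.val p) (H1.val e) κ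

namespace IsBottom

variable {l κ : ℝ} {p e : H1}

theorem isLeast (h : IsBottom ν l κ p e) (h0 : 0 < ν) (h1 : ν < 1) :
    IsLeast (opSpectrum (opA ν)) l := by
  constructor
  · rintro ⟨S, -, hS⟩
    obtain ⟨he, ee⟩ := h.opEq_e
    have := hS ⟨_, he⟩
    rw [ee, sub_self, map_zero] at this
    exact h.e_ne this.symm
  · intro μ hμ
    by_contra hlt
    exact hμ (mem_opResolventSet h0 h1 (not_le.1 hlt)
      (form_ge_of_formGap energy_symm h.neg.le h.pos.le h.gap h.orth h.opEq_p.isWeakSolution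
        h.opEq_e.isWeakSolution h.p_ne h.e_ne))

theorem lam_eq (h : IsBottom ν l κ p e) (h0 : 0 < ν) (h1 : ν < 1) : lam ν = l :=
  (h.isLeast h0 h1).csInf_eq

theorem norm_le (h : IsBottom ν l κ p e) {u f : L2R} (hu : OpEq ν u f)
    (hp : inner ℝ (H1.val p) u = 0) (he : inner ℝ (H1.val e) u = 0) : κ * ‖u‖ ≤ ‖f‖ := by
  obtain ⟨v, rfl, hv⟩ := hu.exists_H1
  have h₁ := h.gap v hp he
  rw [hv v] at h₁
  have h₂ := real_inner_le_norm f (H1.val v)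
  rcases (norm_nonneg (H1.val v)).eq_or_lt with h | h
  · rw [← h, mul_zero]
    exact norm_nonneg f
  · refine le_of_mul_le_mul_right ?_ h
    linarith

theorem exists_opEq (h : IsBottom ν l κ p e) (h0 : 0 < ν) (h1 : ν < 1) {f : L2R}
    (hp : inner ℝ (H1.val p) f = 0) (he : inner ℝ (H1.val e) f = 0) :
    ∃ u, OpEq ν u f ∧ inner ℝ (H1.val p) u = 0 ∧ inner ℝ (H1.val e) u = 0 := by
  obtain ⟨v, α, β, hvp, hve, hv⟩ := exists_inner_eq_zero_of_formGap (mass_pos h1)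
    (energy_garding h0 h1) h.orth h.gap h.pos f
  have hv' := hv.opEq h1
  have hep : inner ℝ (H1.val e) (H1.val p) = 0 := by rw [real_inner_comm, h.orth]
  have hα : α • H1.val p = 0 := by
    have := h.opEq_p.inner_comm hv'
    simp only [inner_zero_left, zero_smul, add_zero, inner_add_right, inner_smul_right, hp,
      h.orth, mul_zero, zero_add, zero_eq_mul, inner_self_eq_zero] at this
    rcases this with this | this <;> simp [this]
  have hβ : β • H1.val e = 0 := by
    have := h.opEq_e.inner_comm hv'
    simp only [inner_smul_left, hve, zero_smul, add_zero, inner_add_right, inner_smul_right, he,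
      hep, mul_zero, zero_add, zero_eq_mul, inner_self_eq_zero] at this
    rcases this with this | this <;> simp [this]
  rw [hα, hβ, zero_smul, add_zero, add_zero, add_zero] at hv'
  exact ⟨_, hv', hvp, hve⟩

/-- The component `w` of an eigenvector orthogonal to `p` and `e` satisfies `κ ‖w‖² ≤ μ ‖w‖²` with
`μ ≤ 0 < κ`, so it vanishes. -/
theorem eigenspace_le (h : IsBottom ν l κ p e) {μ : ℝ} (hμ : μ ≤ 0) {u : L2R}
    (hu : u ∈ opEigenspace (opA ν) μ) : ∃ a b : ℝ, u = a • H1.val p + b • H1.val e := by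
  have hu' : OpEq ν u (μ • u) := hu
  have hNp : ‖H1.val p‖ ^ 2 ≠ 0 := pow_ne_zero 2 (norm_ne_zero_iff.2 h.p_ne)
  have hNe : ‖H1.val e‖ ^ 2 ≠ 0 := pow_ne_zero 2 (norm_ne_zero_iff.2 h.e_ne)
  have hep : inner ℝ (H1.val e) (H1.val p) = 0 := by rw [real_inner_comm, h.orth]
  set a := inner ℝ (H1.val p) u / ‖H1.val p‖ ^ 2 with ha
  set b := inner ℝ (H1.val e) u / ‖H1.val e‖ ^ 2 with hb
  have hw := (hu'.sub (h.opEq_p.smul a)).sub (h.opEq_e.smul b)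
  set w := u - a • H1.val p - b • H1.val e with hwdef
  have hwp : inner ℝ (H1.val p) w = 0 := by
    rw [hwdef, inner_sub_right, inner_sub_right, inner_smul_right, inner_smul_right, h.orth,
      real_inner_self_eq_norm_sq, ha, div_mul_cancel₀ _ hNp]
    ring
  have hwe : inner ℝ (H1.val e) w = 0 := by
    rw [hwdef, inner_sub_right, inner_sub_right, inner_smul_right, inner_smul_right, hep,
      real_inner_self_eq_norm_sq, hb, div_mul_cancel₀ _ hNe]
    ring
  have hu_eq : u = w + a • H1.val p + b • H1.val e := by
    rw [hwdef]
    abel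
  have hw0 : w = 0 := by
    obtain ⟨v, hv, hvw⟩ := hw.exists_H1
    have h₁ := h.gap v (by rw [hv, hwp]) (by rw [hv, hwe])
    rw [hvw v, hv, smul_zero, sub_zero, inner_sub_left, inner_smul_left, inner_smul_left,
      inner_smul_left, hwe, hu_eq, inner_add_left, inner_add_left, inner_smul_left,
      inner_smul_left, hwp, hwe, real_inner_self_eq_norm_sq] at h₁
    simp only [conj_trivial, mul_zero, add_zero, sub_zero] at h₁
    have h₂ := h.pos
    have h₃ : 0 < κ - μ := by linarith
    have h₄ : (κ - μ) * ‖w‖ ^ 2 ≤ 0 := by linarith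
    have h₅ := nonpos_of_mul_nonpos_right h₄ h₃
    exact norm_eq_zero.1 (pow_eq_zero_iff two_ne_zero |>.1 (le_antisymm h₅ (sq_nonneg _)))
  exact ⟨a, b, by rw [hu_eq, hw0, zero_add]⟩

theorem proj_eq (h : IsBottom ν l κ p e) (h0 : 0 < ν) (h1 : ν < 1) {f : L2R} {a b : ℝ}
    (hp : inner ℝ (H1.val p) (f - (a • H1.val p + b • H1.val e)) = 0)
    (he : inner ℝ (H1.val e) (f - (a • H1.val p + b • H1.val e)) = 0) :
    proj ν f = a • H1.val p + b • H1.val e := by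
  have hl := h.lam_eq h0 h1
  have hpm : H1.val p ∈ opEigenspace (opA ν) 0 := by
    have := h.opEq_p
    rw [← zero_smul ℝ (H1.val p)] at this
    exact this
  have hem : H1.val e ∈ opEigenspace (opA ν) (lam ν) := by
    rw [hl]
    exact h.opEq_e
  refine Submodule.eq_starProjection_of_mem_of_inner_eq_zero
    (Submodule.le_topologicalClosure _ (Submodule.add_mem_sup (Submodule.smul_mem _ a hpm)
      (Submodule.smul_mem _ b hem))) fun w hw => ?_
  have hle : opEigenspace (opA ν) 0 ⊔ opEigenspace (opA ν) (lam ν) ≤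
      (Submodule.span ℝ {f - (a • H1.val p + b • H1.val e)})ᗮ := by
    rw [hl]
    refine sup_le (fun u hu => ?_) fun u hu => ?_ <;>
      rw [Submodule.mem_orthogonal_singleton_iff_inner_right]
    · obtain ⟨c, d, rfl⟩ := h.eigenspace_le le_rfl hu
      rw [real_inner_comm, inner_add_left, inner_smul_left, inner_smul_left, hp, he]
      simp
    · obtain ⟨c, d, rfl⟩ := h.eigenspace_le h.neg.le hu
      rw [real_inner_comm, inner_add_left, inner_smul_left, inner_smul_left, hp, he]
      simp
  exact (Submodule.mem_orthogonal_singleton_iff_inner_right).1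
    (Submodule.topologicalClosure_minimal _ hle (Submodule.isClosed_orthogonal _) hw)

theorem proj_eq_zero_iff (h : IsBottom ν l κ p e) (h0 : 0 < ν) (h1 : ν < 1) {f : L2R} :
    proj ν f = 0 ↔ inner ℝ (H1.val p) f = 0 ∧ inner ℝ (H1.val e) f = 0 := by
  have hNp : ‖H1.val p‖ ^ 2 ≠ 0 := pow_ne_zero 2 (norm_ne_zero_iff.2 h.p_ne)
  have hNe : ‖H1.val e‖ ^ 2 ≠ 0 := pow_ne_zero 2 (norm_ne_zero_iff.2 h.e_ne)
  have hep : inner ℝ (H1.val e) (H1.val p) = 0 := by rw [real_inner_comm, h.orth]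
  have key := h.proj_eq h0 h1 (f := f) (a := inner ℝ (H1.val p) f / ‖H1.val p‖ ^ 2)
    (b := inner ℝ (H1.val e) f / ‖H1.val e‖ ^ 2) (by
      rw [inner_sub_right, inner_add_right, inner_smul_right, inner_smul_right, h.orth,
        real_inner_self_eq_norm_sq, div_mul_cancel₀ _ hNp]
      ring) (by
      rw [inner_sub_right, inner_add_right, inner_smul_right, inner_smul_right, hep,
        real_inner_self_eq_norm_sq, div_mul_cancel₀ _ hNe]
      ring)
  constructor
  · intro hz
    rw [hz] at key
    have k₁ := congrArg (inner ℝ (H1.val p)) key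
    have k₂ := congrArg (inner ℝ (H1.val e)) key
    rw [inner_zero_right, inner_add_right, inner_smul_right, inner_smul_right, h.orth,
      real_inner_self_eq_norm_sq, div_mul_cancel₀ _ hNp] at k₁
    rw [inner_zero_right, inner_add_right, inner_smul_right, inner_smul_right, hep,
      real_inner_self_eq_norm_sq, div_mul_cancel₀ _ hNe] at k₂
    exact ⟨by linarith, by linarith⟩
  · rintro ⟨hp, he⟩
    rw [key, hp, he]
    simp

end IsBottom

/-! ## Construction of the ground state -/

theorem rho_norm_sq_le (h0 : 0 < ν) (h1 : ν ≤ 1 / 2) (h1' : ν < 1) :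
    ‖(memLp_rho h0 h1').toLp (rho ν)‖ ^ 2 ≤ 100 * (ν ^ 2 * shelf ν) := by
  rw [norm_sq_rho h0 h1']
  exact integral_rho_sq_le h0 h1

theorem sq_mul_shelf_le (h0 : 0 < ν) : ν ^ 2 * shelf ν ≤ ν * √ν := by
  have hs := Real.sqrt_pos.2 h0
  have hν := Real.sq_sqrt h0.le
  have hL := shelf_le h0
  rw [le_div_iff₀ hs] at hL
  have : ν ^ 2 * shelf ν = ν * √ν * (shelf ν * √ν) := by
    linear_combination (-ν * shelf ν) * hν
  rw [this]
  exact mul_le_of_le_one_right (by positivity) hL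

theorem exists_isBottom (h0 : 0 < ν) (h1 : ν < 1) (hs : √ν ≤ 1 / 1000) :
    ∃ (l : ℝ) (e : H1), IsBottom ν l (1 / 600) (translationMode h0 h1) e ∧
      |l + 3 * ν / 2| ≤ 241000 * (ν * √ν) ∧
      inner ℝ (H1.val (breathingMode h0 h1)) (H1.val e) =
        ‖H1.val (breathingMode h0 h1)‖ ^ 2 := by
  have hs0 := Real.sqrt_pos.2 h0
  have hν := Real.sq_sqrt h0.le
  have hν1 : ν ≤ 1 / 1000000 := by nlinarith
  set ρ := (memLp_rho h0 h1).toLp (rho ν) with hρ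
  have hN := abs_le.1 (integral_sigma_sq h0 hs)
  have hI := abs_le.1 (integral_sigma_mul_rho h0 hs)
  rw [← norm_sq_breathingMode h0 h1] at hN
  rw [← inner_rho_breathingMode h0 h1, ← hρ] at hI
  have hR := (rho_norm_sq_le h0 (by linarith) h1).trans
    (mul_le_mul_of_nonneg_left (sq_mul_shelf_le h0) (by norm_num))
  rw [← hρ] at hR
  have hσ := breathingMode_mem h0 h1
  have hgap := formGap_energy h0 h1 hs
  have hσp := inner_translationMode_breathingMode h0 h1
  have hp := translationMode_mem h0 h1
  set q := breathingMode h0 h1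
  set p := translationMode h0 h1 with hpdef
  set N := ‖H1.val q‖ ^ 2 with hNdef
  set a := inner ℝ ρ (H1.val q) / N with hadef
  have hN0 : 1 / 4 ≤ N := by linarith [hN.1]
  have hq0 : H1.val q ≠ 0 := by
    intro h
    rw [hNdef, h] at hN0
    norm_num at hN0
  have hp0 : H1.val p ≠ 0 := by
    intro h
    have h₂ : pulseDeriv ν =ᵐ[volume] fun _ => (0 : ℝ) := by
      have h₃ := (memLp_pulseDeriv h0 h1).coeFn_toLp
      change (H1.val p : ℝ → ℝ) =ᵐ[volume] _ at h₃
      rw [h] at h₃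
      exact h₃.symm.trans (Lp.coeFn_zero ℝ 2 volume)
    have h₄ := congrFun (Continuous.ae_eq_iff_eq volume (continuous_pulseDeriv ν)
      continuous_const |>.1 h₂) 1
    rw [pulseDeriv] at h₄
    -- Since `(1 - u) sech 2x = √ν u > 0`, the factor `1 - u` is nonzero at `x = 1`, and so is `r'`.
    have h₅ := mul_pos (Real.sqrt_pos.2 h0) (prof_pos ν 1)
    rw [← one_sub_prof_mul] at h₅
    have h₆ : tanhTwo 1 ≠ 0 :=
      div_ne_zero (by rw [Ne, Real.sinh_eq_zero]; norm_num) (Real.cosh_pos _).ne'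
    exact mul_ne_zero (pulse_pos h1 1).ne'
      (neg_ne_zero.2 (mul_ne_zero h₆ (left_ne_zero_of_mul h₅.ne'))) h₄
  have haN : inner ℝ ρ (H1.val q) = a * N := by
    rw [hadef, div_mul_cancel₀ _ (by linarith)]
  have hνs : ν * √ν ≤ ν * (1 / 1000) := by gcongr
  have hνs0 : 0 < ν * √ν := by positivity
  -- The ratio of `-9ν/16` to `3/8` is `-3ν/2`. Both errors are of relative order `√ν`, and `N ≥
  -- 1/4`.
  have ha : |a + 3 * ν / 2| ≤ 1000 * (ν * √ν) := by
    have e : (a + 3 * ν / 2) * N = inner ℝ ρ (H1.val q) + 9 / 16 * ν + 3 / 2 * ν * (N - 3 / 8) := by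
      rw [haN]
      ring
    have h₁ : ν * (N - 3 / 8) ≤ ν * (100 * √ν) := by
      gcongr
      exact hN.2
    have h₂ : ν * -(100 * √ν) ≤ ν * (N - 3 / 8) := by
      gcongr
      exact hN.1
    have h₃ : |(a + 3 * ν / 2) * N| ≤ 250 * (ν * √ν) := by
      rw [e, abs_le]
      constructor <;> linarith [hI.1, hI.2]
    rw [abs_mul, abs_of_pos (by linarith : 0 < N)] at h₃
    have := mul_le_mul_of_nonneg_left hN0 (abs_nonneg (a + 3 * ν / 2))
    linarith
  rw [abs_le] at ha
  have ha0 : a < 0 := by linarith [ha.2]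
  obtain ⟨l, e, hl₁, hl₂, hpe, hqe, he⟩ := exists_groundState energy_symm (mass_pos h1)
    (energy_garding h0 h1) hσp hp hp0 hσ hq0 (by norm_num) hgap ha0 haN
  have hl0 : l < 0 := hl₁.trans_lt ha0
  have he0 : H1.val e ≠ 0 := by
    intro h
    rw [h, inner_zero_right] at hqe
    linarith
  refine ⟨l, e, ⟨hl0, by norm_num, hp.opEq h1, he.opEq h1, hpe, hp0, he0,
    formGap_of_groundState energy_symm (by norm_num) hl0.le hgap hq0 hpe hqe he⟩, ?_, hqe⟩
  have h₃ : ‖ρ‖ ^ 2 / (1 / 600 * N) ≤ 240000 * (ν * √ν) := by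
    rw [div_le_iff₀ (by linarith)]
    nlinarith
  rw [abs_le]
  constructor <;> linarith [ha.1, ha.2]

end

end PulseOperator

/-! ### Proof of the theorem from the gap and the ground state -/

open PulseOperator in
theorem theorem2p8 :
    ∃ ν₀ C : ℝ, 0 < ν₀ ∧ ν₀ ≤ 1 ∧ ∀ ν : ℝ, 0 < ν → ν < ν₀ →
      ∃ (hσ : MemLp (sigma ν) 2 (volume : Measure ℝ))
        (hρ : MemLp (rho ν) 2 (volume : Measure ℝ)),
        let σ : L2R := hσ.toLp (sigma ν)
        let ρ : L2R := hρ.toLp (rho ν)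
        σ ∈ H2 ∧ proj ν σ ∈ H2 ∧
        H2norm (σ - proj ν σ) ≤ C * (ν * √(shelf ν)) ∧
        IsLeast (opSpectrum (opA ν)) (lam ν) ∧
        |lam ν + 3 * ν / 2| ≤ C * ν ^ (3 / 2 : ℝ) ∧
        (proj ν σ ≠ 0 ∧ proj ν σ ∈ opEigenspace (opA ν) (lam ν)) ∧
        ∃ τ : (opA ν).domain,
          (proj ν τ = 0 ∧ opA ν τ = (lam ν • σ - ρ) - proj ν (lam ν • σ - ρ)) ∧
          (∀ τ' : (opA ν).domain,
            proj ν τ' = 0 ∧ opA ν τ' = (lam ν • σ - ρ) - proj ν (lam ν • σ - ρ) → τ' = τ) ∧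
          H2norm (proj ν σ - σ - τ) ≤ C * (ν ^ 2 * √(shelf ν)) := by
  -- The bound on `ν` is what gives `√ν ≤ 1/1000`. The largest constant needed is `(8 + 25 · 600) ·
  -- 250 · 6000`, for the last estimate.
  refine ⟨1 / 1000000, 10 ^ 11, by norm_num, by norm_num, fun ν h0 hν => ?_⟩
  have h1 : ν < 1 := by linarith
  have hs : √ν ≤ 1 / 1000 := Real.sqrt_le_iff.2 ⟨by norm_num, by norm_num; linarith⟩
  refine ⟨memLp_sigma h0 h1, memLp_rho h0 h1, ?_⟩
  intro σ ρ
  obtain ⟨l, e, hb, hl, hσe⟩ := exists_isBottom h0 h1 hs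
  have hσe' : inner ℝ σ (H1.val e) = ‖σ‖ ^ 2 := hσe
  have hpσ : inner ℝ (H1.val (translationMode h0 h1)) σ = 0 :=
    inner_translationMode_breathingMode h0 h1
  have hσρ : OpEq ν σ ρ := (breathingMode_mem h0 h1).opEq h1
  have hρn : ‖ρ‖ ≤ 10 * (ν * √(shelf ν)) := by
    have hL : 0 ≤ shelf ν := (by norm_num : (0 : ℝ) ≤ 1 / 3).trans (shelf_ge h0 h1.le)
    refine le_of_sq_le_sq ?_ (by positivity)
    rw [mul_pow, mul_pow, Real.sq_sqrt hL]
    norm_num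
    exact rho_norm_sq_le h0 (by linarith) h1
  rw [hb.lam_eq h0 h1]
  set p := translationMode h0 h1
  have hNe : 0 < ‖H1.val e‖ ^ 2 := pow_pos (norm_pos_iff.2 hb.e_ne) 2
  have heσ : inner ℝ (H1.val e) σ = ‖σ‖ ^ 2 := by rw [real_inner_comm, hσe']
  have hσ0 : 0 < ‖σ‖ ^ 2 := by
    have := abs_le.1 (integral_sigma_sq h0 hs)
    rw [← norm_sq_breathingMode h0 h1] at this
    change _ ≤ ‖σ‖ ^ 2 - _ ∧ _ at this
    linarith [this.1]
  set b := ‖σ‖ ^ 2 / ‖H1.val e‖ ^ 2 with hbdef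
  have hbe : b * ‖H1.val e‖ ^ 2 = ‖σ‖ ^ 2 := div_mul_cancel₀ _ hNe.ne'
  have hb0 : 0 < b := div_pos hσ0 hNe
  have hpρ : inner ℝ (H1.val p) ρ = 0 := by
    rw [← hb.opEq_p.inner_comm hσρ, inner_zero_left]
  have heρ : inner ℝ (H1.val e) ρ = l * ‖σ‖ ^ 2 := by
    rw [← hb.opEq_e.inner_comm hσρ, inner_smul_left, heσ]
    simp
  have hPσ : proj ν σ = b • H1.val e := by
    rw [hb.proj_eq h0 h1 (f := σ) (a := 0) (b := b) (by
      simp [inner_sub_right, inner_smul_right, hpσ, hb.orth]) (by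
      simp [inner_sub_right, inner_smul_right, heσ, hbe])]
    simp
  have hPρ : proj ν ρ = (l * b) • H1.val e := by
    rw [hb.proj_eq h0 h1 (f := ρ) (a := 0) (b := l * b) (by
      simp [inner_sub_right, inner_smul_right, hpρ, hb.orth]) (by
      simp [inner_sub_right, inner_smul_right, heρ, mul_assoc, hbe])]
    simp
  have hee := hb.opEq_e.smul b
  obtain ⟨y, hy⟩ : ∃ y, y = σ - b • H1.val e := ⟨_, rfl⟩
  have hyA : OpEq ν y (ρ - (l * b) • H1.val e) := by
    have := hσρ.sub hee
    rwa [smul_smul, mul_comm b l, ← hy] at this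
  have hyp : inner ℝ (H1.val p) y = 0 := by
    simp [hy, inner_sub_right, inner_smul_right, hpσ, hb.orth]
  have hye : inner ℝ (H1.val e) y = 0 := by
    simp [hy, inner_sub_right, inner_smul_right, heσ, hbe]
  -- The subtracted vector is the orthogonal projection `Πρ`.
  have hfn : ‖ρ - (l * b) • H1.val e‖ ≤ ‖ρ‖ := by
    refine le_of_sq_le_sq ?_ (norm_nonneg _)
    rw [norm_sub_sq_real, inner_smul_right, real_inner_comm, heρ, norm_smul, mul_pow,
      Real.norm_eq_abs, sq_abs, ← hbe]
    have : 0 ≤ (l * b) ^ 2 * ‖H1.val e‖ ^ 2 := by positivity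
    nlinarith
  have hyn := hb.norm_le hyA hyp hye
  have hl250 : ‖l‖ ≤ 250 * ν := by
    rw [Real.norm_eq_abs]
    rw [abs_le] at hl ⊢
    have : ν * √ν ≤ ν * (1 / 1000) := by gcongr
    constructor <;> linarith
  -- The correction `d` carries the term `λ y` of the right-hand side. It will be exactly `Πσ - σ -
  -- σ̂`.
  obtain ⟨d, hdA, hdp, hde⟩ := hb.exists_opEq h0 h1 (f := (-l) • y)
    (by rw [inner_smul_right, hyp, mul_zero]) (by rw [inner_smul_right, hye, mul_zero])
  have hdn := hb.norm_le hdA hdp hde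
  rw [norm_smul, norm_neg] at hdn
  have hνL : 0 ≤ ν * √(shelf ν) := by positivity
  have hrhs : l • σ - ρ - proj ν (l • σ - ρ) = l • y - (ρ - (l * b) • H1.val e) := by
    rw [map_sub, map_smul, hPσ, hPρ, hy]
    module
  have hly : ‖l‖ * ‖y‖ ≤ 250 * ν * (6000 * (ν * √(shelf ν))) := by
    gcongr
    linarith
  -- The solution is `σ̂ = -(y + d)`, since `A y = (1 - Π) ρ` and `A d = -λ y`.
  have hτA := (hyA.add hdA).smul (-1)
  have hτeq : OpEq ν ((-1 : ℝ) • (y + d)) (l • y - (ρ - (l * b) • H1.val e)) := by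
    convert hτA using 1
    module
  obtain ⟨hτd, hτ⟩ := hτeq
  refine ⟨hσρ.1, ?_, ?_, hb.isLeast h0 h1, ?_, ⟨?_, ?_⟩, ⟨_, hτd⟩, ⟨?_, ?_⟩, ?_, ?_⟩
  · rw [hPσ]
    exact hee.1
  · rw [hPσ, ← hy]
    refine (hyA.H2norm_le h0 (by linarith)).trans ?_
    linarith
  · rw [show (3 / 2 : ℝ) = 1 + 1 / 2 by norm_num, Real.rpow_add h0, Real.rpow_one,
      ← Real.sqrt_eq_rpow]
    refine hl.trans ?_
    have : 0 ≤ ν * √ν := by positivity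
    linarith
  · rw [hPσ]
    exact smul_ne_zero hb0.ne' hb.e_ne
  · rw [hPσ]
    exact Submodule.smul_mem _ b hb.opEq_e
  · rw [hb.proj_eq_zero_iff h0 h1]
    simp [inner_add_right, hyp, hye, hdp, hde]
  · rw [hrhs]
    exact hτ
  · rintro ⟨τ', h'⟩ ⟨hz, hτ'⟩
    rw [hrhs] at hτ'
    rw [hb.proj_eq_zero_iff h0 h1] at hz
    have hdiff := (show OpEq ν τ' _ from ⟨h', hτ'⟩).sub ⟨hτd, hτ⟩
    rw [sub_self] at hdiff
    have := hb.norm_le hdiff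
      (by simp [inner_sub_right, inner_add_right, hz.1, hyp, hdp])
      (by simp [inner_sub_right, inner_add_right, hz.2, hye, hde])
    rw [norm_zero] at this
    have h₂ := nonpos_of_mul_nonpos_right this hb.pos
    exact Subtype.ext (sub_eq_zero.1 (norm_le_zero_iff.1 h₂))
  · have e₁ : proj ν σ - σ - (-1 : ℝ) • (y + d) = d := by
      rw [hPσ, hy]
      module
    rw [e₁]
    refine (hdA.H2norm_le h0 (by linarith)).trans ?_
    rw [norm_smul, norm_neg]
    have : 0 ≤ ν ^ 2 * √(shelf ν) := by positivity
    linarith
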